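/- For points $a,b,c\in\mathbb R^2$ let $\mathcal T(a,b,c)=\operatorname{sgn}\bigl((b-a)^{\perp}\cdot(c-b)\bigr)$, where $(x,y)^\perp=(-y,x)$; let $\mathrm{LHP}(a,b)=\{c:\mathcal T(a,b,c)\ge 0\}$, $\mathrm{RHP}(a,b)=\mathrm{LHP}(b,a)$, and for $a\ne b$ let $\mathcal L(a,b)$ be the line through $a$ and $b$. A tangent of a polygon $P$ is a line that meets $P$ and has $P$ contained in one of its two closed half-planes. A common tangent of two polygons is a line that is a tangent of both; it is outer if both polygons lie on the same side of it, and separating otherwise. Let $P_0,P_1$ be simple polygons in the plane, where $P_k$ is given by a read-only array of its $n_k\ge 3$ corners $p_k[0],\dots,p_k[n_k-1]$ in counterclockwise order, with indices taken modulo $n_k$. Assume that $P_0$ and $P_1$ have no common corner and that no three of the $n_0+n_1$ corners are collinear. Consider the following algorithm. 1. $s_0\gets 0$; $t_0\gets 1$; $s_1\gets 0$; $t_1\gets 1$; $u\gets 0$. 2. While $t_0<3n_0$ or $t_1<3n_1$, do: if $\mathcal T(p_{1-u}[s_{1-u}],p_u[s_u],p_u[t_u])=1$, then \{ if $t_u\ge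 2n_u$, return NULL and stop; $s_u\gets t_u$; $t_{1-u}\gets s_{1-u}+1$ \}; afterwards, in either case, $t_u\gets t_u+1$ and $u\gets 1-u$. 3. Return $(s_0,s_1)$. The algorithm always terminates, and the following holds. * If $P_0$ and $P_1$ have a separating common tangent, the algorithm returns a pair of indices $(s_0,s_1)$ such that $p_0[s_0]\neq p_1[s_1]$, the line $\mathcal L(p_0[s_0],p_1[s_1])$ is a separating common tangent of $P_0$ and $P_1$, and $P_k\subseteq\mathrm{RHP}(p_{1-k}[s_{1-k}],p_k[s_k])$ for $k=0,1$. * If $P_0$ and $P_1$ have no separating common tangent, the algorithm returns NULL. * The algorithm runs in linear time: the loop is executed at most $6(n_0+n_1)$ times, and on a real RAM the total number of elementary operations is at most $C(n_0+n_1)$, where $C$ is an absolute constant. * The algorithm uses constant workspace: besides the read-only input it stores only the five integers $s_0,s_1,t_0,t_1,u$, which together occupy at most $C\log_2(n_0+n_1)$ bits at any time, where $C$ is an absolute constant. * The algorithm decides whether the convex hulls of $P_0$ and $P_1$ are disjoint: they are disjoint if and only if it does not return NULL. -/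

import Mathlib

noncomputable section

namespace SepTangent

/-! ### Plane geometry -/

/-- The Euclidean plane, in Cartesian coordinates. -/
abbrev Plane : Type := ℝ × ℝ

/-- The dot product. -/
def dot (x y : Plane) : ℝ := x.1 * y.1 + x.2 * y.2

/-- The counterclockwise rotation by the angle `π / 2`. -/
def perp (x : Plane) : Plane := (-x.2, x.1)

/-- `orient a b c` is `1`, `0`, `-1` if `c` is to the left of, on, to the right of the directed line
from `a` to `b`. -/
def orient (a b c : Plane) : SignType := SignType.sign (dot (perp (b - a)) (c - b))

/-- The closed half-plane to the left of the directed line from `a` to `b`. -/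
def LHP (a b : Plane) : Set Plane := {c | 0 ≤ orient a b c}

/-- The closed half-plane to the right of the directed line from `a` to `b`. -/
def RHP (a b : Plane) : Set Plane := LHP b a

/-- The line through `a` and `b` (used for `a ≠ b`). -/
def lineThrough (a b : Plane) : Set Plane := (line[ℝ, a, b] : AffineSubspace ℝ Plane)

/-- The line `ℓ` is a tangent of the set `P`: it meets `P`, and `P` lies in one of the two closed
half-planes defined by `ℓ` (`a` and `b` may be swapped). -/
def IsTangent (ℓ P : Set Plane) : Prop :=
  (ℓ ∩ P).Nonempty ∧ ∃ a b : Plane, a ≠ b ∧ ℓ = lineThrough a b ∧ P ⊆ LHP a b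

/-- The line `ℓ` is a tangent of both `P` and `Q`. -/
def IsCommonTangent (ℓ P Q : Set Plane) : Prop := IsTangent ℓ P ∧ IsTangent ℓ Q

/-- A common tangent with `P` and `Q` on the same side. -/
def IsOuterCommonTangent (ℓ P Q : Set Plane) : Prop :=
  IsCommonTangent ℓ P Q ∧
    ∃ a b : Plane, a ≠ b ∧ ℓ = lineThrough a b ∧ P ⊆ LHP a b ∧ Q ⊆ LHP a b

/-- A common tangent that is not an outer one. -/
def IsSeparatingCommonTangent (ℓ P Q : Set Plane) : Prop :=
  IsCommonTangent ℓ P Q ∧ ¬ IsOuterCommonTangent ℓ P Q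

/-- A simple polygon: at least three corners, all distinct, consecutive edges meet only in their
common corner, and all other pairs of edges are disjoint. -/
structure IsSimple {n : ℕ} (P : Polygon Plane n) : Prop where
  three_le : 3 ≤ n
  injective : Function.Injective P.vertices
  consecutive : ∀ i : Fin n,
    P.edgeSet ℝ i ∩ P.edgeSet ℝ (finRotate n i) = {P (finRotate n i)}
  disjoint : ∀ i j : Fin n, i ≠ j → j ≠ finRotate n i → i ≠ finRotate n j →
    Disjoint (P.edgeSet ℝ i) (P.edgeSet ℝ j)

/-- The signed area enclosed by a polygon (shoelace formula). -/
def signedArea {n : ℕ} (P : Polygon Plane n) : ℝ :=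
  (∑ i : Fin n, ((P i).1 * (P (finRotate n i)).2 - (P (finRotate n i)).1 * (P i).2)) / 2

/-- The corners of a simple polygon are listed in counterclockwise order. -/
def IsCounterclockwise {n : ℕ} (P : Polygon Plane n) : Prop := 0 < signedArea P

/-- The two polygons have no common corner, and no three corners in the union of their corner sets
are collinear. -/
def GeneralPosition {n : Fin 2 → ℕ} (P : (k : Fin 2) → Polygon Plane (n k)) : Prop :=
  (∀ (i : Fin (n 0)) (j : Fin (n 1)), P 0 i ≠ P 1 j) ∧
  ∀ a ∈ ⋃ k, Set.range (P k).vertices, ∀ b ∈ ⋃ k, Set.range (P k).vertices,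
    ∀ c ∈ ⋃ k, Set.range (P k).vertices,
      a ≠ b → b ≠ c → a ≠ c → ¬ Collinear ℝ ({a, b, c} : Set Plane)

/-- The corner with index `i`, where indices are taken modulo the number of corners. -/
def corner {n : ℕ} [NeZero n] (P : Polygon Plane n) (i : ℕ) : Plane := P (Fin.ofNat n i)

/-! ### A real RAM with read-only input

The input consists of two polygons, each a read-only array of corners. The workspace consists of `w`
words that hold natural numbers and may be addressed indirectly. Real numbers are never stored: a
test evaluates one fixed polynomial expression in input coordinates. Every operation has cost one. -/

/-- Expressions whose value is a natural number. -/
inductive NExp : Type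
  /-- a constant -/
  | const (c : ℕ)
  /-- the content of the workspace word with the given address -/
  | word (a : NExp)
  /-- the number of corners of input polygon `k` -/
  | len (k : NExp)
  | add (a b : NExp)
  | sub (a b : NExp)
  | mul (a b : NExp)

/-- Expressions whose value is a real number. -/
inductive RExp : Type
  /-- the first coordinate of corner `i` of polygon `k` -/
  | fst (k i : NExp)
  /-- the second coordinate of corner `i` of polygon `k` -/
  | snd (k i : NExp)
  | add (a b : RExp)
  | sub (a b : RExp)
  | mul (a b : RExp)

/-- Tests on which a program can branch. -/
inductive Test : Type
  | lt (a b : NExp)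
  | pos (a : RExp)
  | or (a b : Test)

/-- Instructions. `branch c l l'` continues at line `l` if the test `c` succeeds and at line `l'`
otherwise, a `store` continues at the next line, and the two `return` instructions halt. -/
inductive Instr : Type
  | store (addr val : NExp)
  | branch (c : Test) (l l' : ℕ)
  | goto (l : ℕ)
  | returnNull
  | returnPair (a b : NExp)

/-- A program is a list of instructions, numbered from `0`. -/
abbrev Program : Type := List Instr

/-- The machine is running, at a program line with a given workspace content, or it has halted with
an output, `none` standing for `NULL`. -/
inductive State (w : ℕ) : Type
  | running (line : ℕ) (mem : Fin w → ℕ)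
  | halted (output : Option (ℕ × ℕ))

/-- The number of operations in an expression. -/
def NExp.cost : NExp → ℕ
  | const _ => 1
  | word a => a.cost + 1
  | len k => k.cost + 1
  | add a b => a.cost + b.cost + 1
  | sub a b => a.cost + b.cost + 1
  | mul a b => a.cost + b.cost + 1

/-- The number of operations in an expression. -/
def RExp.cost : RExp → ℕ
  | fst k i => k.cost + i.cost + 1
  | snd k i => k.cost + i.cost + 1
  | add a b => a.cost + b.cost + 1
  | sub a b => a.cost + b.cost + 1
  | mul a b => a.cost + b.cost + 1

/-- The number of operations in a test. -/
def Test.cost : Test → ℕ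
  | lt a b => a.cost + b.cost + 1
  | pos a => a.cost + 1
  | or a b => a.cost + b.cost + 1

/-- The number of operations of one execution of an instruction. -/
def Instr.cost : Instr → ℕ
  | store a v => a.cost + v.cost + 1
  | branch c _ _ => c.cost + 1
  | goto _ => 1
  | returnNull => 1
  | returnPair a b => a.cost + b.cost + 1

section Semantics

variable {n : Fin 2 → ℕ} [∀ k, NeZero (n k)] (P : (k : Fin 2) → Polygon Plane (n k)) {w : ℕ}

/-- The value of an expression; polygon numbers are read modulo `2` and corner indices modulo the
number of corners, and words outside the workspace read as `0`. -/
def NExp.eval (n : Fin 2 → ℕ) {w : ℕ} (m : Fin w → ℕ) : NExp → ℕ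
  | const c => c
  | word a => if h : a.eval n m < w then m ⟨a.eval n m, h⟩ else 0
  | len k => n (Fin.ofNat 2 (k.eval n m))
  | add a b => a.eval n m + b.eval n m
  | sub a b => a.eval n m - b.eval n m
  | mul a b => a.eval n m * b.eval n m

/-- Corner `i` of polygon `k` of the input. -/
def inputCorner (k i : ℕ) : Plane := corner (P (Fin.ofNat 2 k)) i

/-- The value of a real expression. -/
def RExp.eval (m : Fin w → ℕ) : RExp → ℝ
  | fst k i => (inputCorner P (k.eval n m) (i.eval n m)).1
  | snd k i => (inputCorner P (k.eval n m) (i.eval n m)).2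
  | add a b => a.eval m + b.eval m
  | sub a b => a.eval m - b.eval m
  | mul a b => a.eval m * b.eval m

/-- Success of a test. -/
def Test.Holds (m : Fin w → ℕ) : Test → Prop
  | lt a b => a.eval n m < b.eval n m
  | pos a => 0 < a.eval P m
  | or a b => a.Holds m ∨ b.Holds m

open Classical in
/-- Execution of one instruction at line `l` with workspace content `m`. A store outside the
workspace has no effect. -/
def Instr.exec (l : ℕ) (m : Fin w → ℕ) : Instr → State w
  | store a v => .running (l + 1) fun j => if (j : ℕ) = a.eval n m then v.eval n m else m j
  | branch c l₁ l₂ => .running (if c.Holds P m then l₁ else l₂) m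
  | goto l₁ => .running l₁ m
  | returnNull => .halted none
  | returnPair a b => .halted (some (a.eval n m, b.eval n m))

/-- One step of the machine. A halted machine stays halted; outside the program the machine is stuck
and never halts. -/
def step (prog : Program) : State w → State w
  | .halted r => .halted r
  | .running l m =>
    match prog[l]? with
    | some I => I.exec P l m
    | none => .running l m

/-- The state after `j` steps, starting at line `0` with all words `0`. -/
def run (prog : Program) (w : ℕ) (j : ℕ) : State w :=
  (step P prog)^[j] (.running 0 fun _ => 0)

/-- The cost of the step taken from a state. -/
def State.stepCost (prog : Program) : State w → ℕ
  | .halted _ => 0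
  | .running l _ =>
    match prog[l]? with
    | some I => I.cost
    | none => 1

/-- The number of operations performed in the first `j` steps. -/
def runTime (prog : Program) (w : ℕ) (j : ℕ) : ℕ :=
  ∑ i ∈ Finset.range j, (run P prog w i).stepCost prog

/-- The machine is about to execute line `l`. -/
def State.AtLine (l : ℕ) : State w → Prop
  | .halted _ => False
  | .running l' _ => l' = l

open Classical in
/-- How often line `l` is executed in the first `j` steps. -/
def visits (prog : Program) (w : ℕ) (l : ℕ) (j : ℕ) : ℕ :=
  ((Finset.range j).filter fun i => (run P prog w i).AtLine l).card

/-- The number of bits needed to store the workspace content. -/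
def State.bits : State w → ℕ
  | .halted _ => 0
  | .running _ m => ∑ a : Fin w, Nat.size (m a)

end Semantics

/-! ### The algorithm -/

namespace Alg

/-- The word that holds `s k`. -/
def sAddr (k : NExp) : NExp := k

/-- The word that holds `t k`. -/
def tAddr (k : NExp) : NExp := .add (.const 2) k

/-- The word that holds `u`. -/
def uAddr : NExp := .const 4

/-- The variable `s k`. -/
def s (k : NExp) : NExp := .word (sAddr k)

/-- The variable `t k`. -/
def t (k : NExp) : NExp := .word (tAddr k)

/-- The variable `u`. -/
def u : NExp := .word uAddr

/-- The value `1 - u`. -/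
def u' : NExp := .sub (.const 1) u

/-- The test `orient (p k i) (p k' i') (p k'' i'') = 1` in coordinates. -/
def leftTest (k i k' i' k'' i'' : NExp) : Test :=
  .pos (.sub
    (.mul (.sub (.fst k' i') (.fst k i)) (.sub (.snd k'' i'') (.snd k' i')))
    (.mul (.sub (.snd k' i') (.snd k i)) (.sub (.fst k'' i'') (.fst k' i'))))

end Alg

open Alg in
/-- The algorithm `SeparatingCommonTangent`:

    s 0 ← 0;  t 0 ← 1;  s 1 ← 0;  t 1 ← 1;  u ← 0
    while t 0 < 3 * n 0 or t 1 < 3 * n 1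
      if orient (p (1-u) (s (1-u))) (p u (s u)) (p u (t u)) = 1
        if t u ≥ 2 * n u
          return NULL
        s u ← t u
        t (1-u) ← s (1-u) + 1
      t u ← t u + 1
      u ← 1 - u
    return (s 0, s 1)
-/
def separatingCommonTangent : Program :=
  [ /-  0 -/ .store (sAddr (.const 0)) (.const 0),
    /-  1 -/ .store (tAddr (.const 0)) (.const 1),
    /-  2 -/ .store (sAddr (.const 1)) (.const 0),
    /-  3 -/ .store (tAddr (.const 1)) (.const 1),
    /-  4 -/ .store uAddr (.const 0),
    /-  5 -/ .branch (.or
        (.lt (t (.const 0)) (.mul (.const 3) (.len (.const 0))))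
        (.lt (t (.const 1)) (.mul (.const 3) (.len (.const 1))))) 6 14,
    /-  6 -/ .branch (leftTest u' (s u') u (s u) u (t u)) 7 11,
    /-  7 -/ .branch (.lt (t u) (.mul (.const 2) (.len u))) 9 8,
    /-  8 -/ .returnNull,
    /-  9 -/ .store (sAddr u) (t u),
    /- 10 -/ .store (tAddr u') (.add (s u') (.const 1)),
    /- 11 -/ .store (tAddr u) (.add (t u) (.const 1)),
    /- 12 -/ .store uAddr u',
    /- 13 -/ .goto 5,
    /- 14 -/ .returnPair (s (.const 0)) (s (.const 1)) ]

/-- The number of words in the workspace of the algorithm: `s 0`, `s 1`, `t 0`, `t 1`, `u`. -/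
def algWords : ℕ := 5

/-- The first line of the body of the loop, executed once in every iteration. -/
def loopBodyLine : ℕ := 6

end SepTangent

end

noncomputable section

namespace SepTangent

/-! ### Vertical sweep over a polygon -/

/-! Correctness of a returned pair is local. No corner of `P k` with index in `[s k, t k)` is
strictly to the left of the line from the current corner of the other polygon to the corner `s k`
(`LoopInvariant`). Since `s k < 2 * n k`, leaving the loop with `3 * n k ≤ t k` means that a full
round was tested. The result is an `IsTangentPair`, which in general position spans a separating
common tangent and makes the convex hulls disjoint. Conversely, a separating common tangent forces
disjoint hulls (`disjoint_of_separating`). Termination is linear because every iteration increases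
`s 0 + s 1 + t 0 + t 1`, while `t 0 - s 0` and `t 1 - s 1` differ by at most one.

What remains is that NULL is never returned when the hulls are disjoint: no index reaches `2 * n k`.
Choose coordinates in which the polygon `p` is strictly to the left of the other one. A move
strictly increases the slope of the line joining the two current corners; the largest slope belongs
to the tangent, which touches `p` in a corner `p r` with `r < n`. The invariant `Bounded` says that
`s ≤ r`, or that `s ≤ r + n` and every observer on or above the line through `p s` and the current
observer `q` sees its lowest corner at an index in `[s, r + n]`. If the observer moves, the line
rises and fewer observers are concerned. If `s` moves to `t` (`Observed.bounded_advance`), let `p a`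
be the lowest corner seen from `q`. Observers on or above the line through `p a` and `q` have their
lowest corners on the lower hull from `p a` to `p r`, hence at indices from `a` to `r + n`. The
others lie in a wedge beyond `q`, and none of the skipped corners is lowest from there.

This rests on the fact that the lower hull corners of a counterclockwise polygon appear from left to
right (`SweepPolygon.exists_modEq_of_isLower`), proved by crossing parities. The parity of the
number of edges below a point of an edge, corrected by the direction of that edge, is constant along
the polygon (`SweepPolygon.exists_edgeParity_eq`). Integrating signed heights ties this constant to
the sign of the shoelace area (`SweepPolygon.area_nonpos`). A parity count against the path between
two lower corners then excludes the wrong cyclic order (`SweepPolygon.not_lower_order_of_zero`). -/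

/-- The ordinate at the abscissa `t` of the line through `a` and `b`. -/
def lineAt (a b : Plane) (t : ℝ) : ℝ := a.2 + (t - a.1) * ((b.2 - a.2) / (b.1 - a.1))

/-- `t` lies strictly between `a` and `b`, in either order. -/
def Between (a b t : ℝ) : Prop := (a < t ∧ t < b) ∨ (b < t ∧ t < a)

open Classical in
/-- Indicator modulo `2` of a proposition. -/
def ind (p : Prop) : ZMod 2 := if p then 1 else 0

/-- The segment `a b` passes strictly below `z`. -/
def below (a b z : Plane) : ZMod 2 := ind (Between a.1 b.1 z.1 ∧ lineAt a b z.1 < z.2)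

/-- The segment `a b` passes strictly above `z`. -/
def above (a b z : Plane) : ZMod 2 := ind (Between a.1 b.1 z.1 ∧ z.2 < lineAt a b z.1)

lemma ind_true {p : Prop} (h : p) : ind p = 1 := by simp [ind, h]

lemma ind_false {p : Prop} (h : ¬ p) : ind p = 0 := by simp [ind, h]

lemma ind_congr {p q : Prop} (h : p ↔ q) : ind p = ind q := by rw [propext h]

lemma add_self_zmod_two (a : ZMod 2) : a + a = 0 := CharTwo.add_self_eq_zero a

lemma between_comm {a b t : ℝ} : Between a b t ↔ Between b a t := Or.comm

lemma ind_between {a b t : ℝ} (ha : a ≠ t) (hb : b ≠ t) :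
    ind (Between a b t) = ind (a < t) + ind (b < t) := by
  have h11 : (1 : ZMod 2) + 1 = 0 := rfl
  rcases lt_or_gt_of_ne ha with h | h <;> rcases lt_or_gt_of_ne hb with h' | h' <;>
    simp [ind, Between, h, h', h.le, h'.le, not_lt.2, h11]

lemma ind_lt_add_ind_lt {a b : ℝ} (h : a ≠ b) : ind (a < b) + ind (b < a) = 1 := by
  rcases lt_or_gt_of_ne h with h | h <;> simp [ind, h, not_lt.2 h.le]

/-- For each of the four pairs of an end point of one interval and an end point of the other,
exactly one of the two strict inequalities holds. The four ones cancel modulo `2`. -/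
lemma ind_between_interleave {a b z w : ℝ} (h1 : a ≠ z) (h2 : b ≠ z) (h3 : a ≠ w) (h4 : b ≠ w) :
    ind (Between a b z) + ind (Between a b w) = ind (Between z w a) + ind (Between z w b) := by
  rw [ind_between h1 h2, ind_between h3 h4, ind_between h1.symm h3.symm,
    ind_between h2.symm h4.symm]
  have h0 : (2 : ZMod 2) = 0 := rfl
  linear_combination ind_lt_add_ind_lt h1 + ind_lt_add_ind_lt h2 + ind_lt_add_ind_lt h3 +
    ind_lt_add_ind_lt h4 + (2 - ind (z < a) - ind (z < b) - ind (w < a) - ind (w < b)) *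
    h0

lemma lineAt_symm {a b : Plane} (h : a.1 ≠ b.1) (t : ℝ) : lineAt a b t = lineAt b a t := by
  have h1 : b.1 - a.1 ≠ 0 := sub_ne_zero.2 h.symm
  have h2 : a.1 - b.1 ≠ 0 := sub_ne_zero.2 h
  unfold lineAt
  field_simp
  ring

lemma lineAt_fst (a b : Plane) : lineAt a b a.1 = a.2 := by simp [lineAt]

lemma lineAt_snd {a b : Plane} (h : a.1 ≠ b.1) : lineAt a b b.1 = b.2 := by
  rw [lineAt_symm h, lineAt_fst]

lemma below_comm {a b : Plane} (h : a.1 ≠ b.1) (z : Plane) : below a b z = below b a z := by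
  unfold below
  rw [lineAt_symm h]
  exact ind_congr (and_congr_left fun _ => between_comm)

lemma above_comm {a b : Plane} (h : a.1 ≠ b.1) (z : Plane) : above a b z = above b a z := by
  unfold above
  rw [lineAt_symm h]
  exact ind_congr (and_congr_left fun _ => between_comm)

lemma continuous_lineAt (a b : Plane) : Continuous (lineAt a b) := by
  unfold lineAt
  fun_prop

lemma mem_uIcc_of_between {a b t : ℝ} (h : Between a b t) : t ∈ Set.uIcc a b := by
  rw [Set.mem_uIcc]
  rcases h with h | h
  · exact Or.inl ⟨h.1.le, h.2.le⟩
  · exact Or.inr ⟨h.1.le, h.2.le⟩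

lemma lineAt_mem_segment {a b : Plane} (h : a.1 ≠ b.1) {t : ℝ} (ht : t ∈ Set.uIcc a.1 b.1) :
    (t, lineAt a b t) ∈ segment ℝ a b := by
  have h1 : b.1 - a.1 ≠ 0 := sub_ne_zero.2 h.symm
  rw [segment_eq_image_lineMap]
  refine ⟨(t - a.1) / (b.1 - a.1), ?_, ?_⟩
  · rw [Set.mem_uIcc] at ht
    rcases lt_or_gt_of_ne h with h | h
    · have : 0 < b.1 - a.1 := sub_pos.2 h
      constructor
      · apply div_nonneg _ this.le
        rcases ht with ht | ht <;> linarith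
      · rw [div_le_one this]
        rcases ht with ht | ht <;> linarith
    · have : b.1 - a.1 < 0 := sub_neg.2 h
      constructor
      · apply div_nonneg_of_nonpos _ this.le
        rcases ht with ht | ht <;> linarith
      · rw [div_le_one_of_neg this]
        rcases ht with ht | ht <;> linarith
  · ext
    · simp only [AffineMap.lineMap_apply, vsub_eq_sub, vadd_eq_add, Prod.fst_add, Prod.smul_fst,
        Prod.fst_sub, smul_eq_mul]
      field_simp
      ring
    · simp only [AffineMap.lineMap_apply, vsub_eq_sub, vadd_eq_add, Prod.snd_add, Prod.smul_snd,
        Prod.snd_sub, smul_eq_mul, lineAt]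
      field_simp
      ring

/-- Of two disjoint segments, one is above the other over their common range of abscissas. -/
lemma lineAt_lt_or_gt_of_disjoint {a b c d : Plane} (hab : a.1 ≠ b.1) (hcd : c.1 ≠ d.1)
    (h : Disjoint (segment ℝ a b) (segment ℝ c d)) :
    (∀ t ∈ Set.uIcc a.1 b.1 ∩ Set.uIcc c.1 d.1, lineAt a b t < lineAt c d t) ∨
      (∀ t ∈ Set.uIcc a.1 b.1 ∩ Set.uIcc c.1 d.1, lineAt c d t < lineAt a b t) := by
  by_contra! hc
  obtain ⟨⟨t, ht, h1⟩, ⟨t', ht', h2⟩⟩ := hc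
  have hconn : (Set.uIcc a.1 b.1 ∩ Set.uIcc c.1 d.1).OrdConnected :=
    Set.OrdConnected.inter Set.ordConnected_uIcc Set.ordConnected_uIcc
  obtain ⟨x, hx, hxe⟩ := hconn.isPreconnected.intermediate_value ht' ht
    (f := fun s => lineAt a b s - lineAt c d s)
    ((continuous_lineAt a b).sub (continuous_lineAt c d)).continuousOn
    (show (0 : ℝ) ∈ Set.Icc _ _ from ⟨sub_nonpos.2 h2, sub_nonneg.2 h1⟩)
  have hxe' : lineAt a b x = lineAt c d x := sub_eq_zero.1 hxe
  refine Set.disjoint_left.1 h (lineAt_mem_segment hab hx.1) ?_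
  rw [hxe']
  exact lineAt_mem_segment hcd hx.2

/-- Crossing parity: for disjoint segments `a b` and `z w`, the number of end points of `z w` above
`a b` and the number of end points of `a b` below `z w` have the same parity. -/
lemma below_add_below {a b z w : Plane} (hab : a.1 ≠ b.1) (hzw : z.1 ≠ w.1)
    (h1 : a.1 ≠ z.1) (h2 : b.1 ≠ z.1) (h3 : a.1 ≠ w.1) (h4 : b.1 ≠ w.1)
    (h : Disjoint (segment ℝ a b) (segment ℝ z w)) :
    below a b z + below a b w = above z w a + above z w b := by
  have hz : lineAt z w z.1 = z.2 := lineAt_fst z w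
  have hw : lineAt z w w.1 = w.2 := lineAt_snd hzw
  have ha : lineAt a b a.1 = a.2 := lineAt_fst a b
  have hb : lineAt a b b.1 = b.2 := lineAt_snd hab
  unfold below above
  rcases lineAt_lt_or_gt_of_disjoint hab hzw h with hlt | hlt
  · rw [ind_congr (and_iff_left_of_imp fun hB : Between a.1 b.1 z.1 => by
        have := hlt _ ⟨mem_uIcc_of_between hB, Set.left_mem_uIcc⟩; rwa [hz] at this),
      ind_congr (and_iff_left_of_imp fun hB : Between a.1 b.1 w.1 => by
        have := hlt _ ⟨mem_uIcc_of_between hB, Set.right_mem_uIcc⟩; rwa [hw] at this),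
      ind_congr (and_iff_left_of_imp fun hB : Between z.1 w.1 a.1 => by
        have := hlt _ ⟨Set.left_mem_uIcc, mem_uIcc_of_between hB⟩; rwa [ha] at this),
      ind_congr (and_iff_left_of_imp fun hB : Between z.1 w.1 b.1 => by
        have := hlt _ ⟨Set.right_mem_uIcc, mem_uIcc_of_between hB⟩; rwa [hb] at this)]
    exact ind_between_interleave h1 h2 h3 h4
  · rw [ind_false, ind_false, ind_false, ind_false]
    · rintro ⟨hB, hl⟩
      have := hlt _ ⟨Set.right_mem_uIcc, mem_uIcc_of_between hB⟩
      rw [hb] at this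
      exact lt_asymm hl this
    · rintro ⟨hB, hl⟩
      have := hlt _ ⟨Set.left_mem_uIcc, mem_uIcc_of_between hB⟩
      rw [ha] at this
      exact lt_asymm hl this
    · rintro ⟨hB, hl⟩
      have := hlt _ ⟨mem_uIcc_of_between hB, Set.right_mem_uIcc⟩
      rw [hw] at this
      exact lt_asymm hl this
    · rintro ⟨hB, hl⟩
      have := hlt _ ⟨mem_uIcc_of_between hB, Set.left_mem_uIcc⟩
      rw [hz] at this
      exact lt_asymm hl this

/-- Crossing parity for a polygonal path that is disjoint from a segment. -/
lemma sum_below_add_below {p : ℕ → Plane} {z w : Plane} (hzw : z.1 ≠ w.1) {i j : ℕ} (hij : i ≤ j)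
    (hp : ∀ k ∈ Finset.Ico i j, (p k).1 ≠ (p (k + 1)).1)
    (hz : ∀ k ∈ Finset.Icc i j, (p k).1 ≠ z.1) (hw : ∀ k ∈ Finset.Icc i j, (p k).1 ≠ w.1)
    (h : ∀ k ∈ Finset.Ico i j, Disjoint (segment ℝ (p k) (p (k + 1))) (segment ℝ z w)) :
    ∑ k ∈ Finset.Ico i j, (below (p k) (p (k + 1)) z + below (p k) (p (k + 1)) w) =
      above z w (p i) + above z w (p j) := by
  induction j, hij using Nat.le_induction with
  | base => simp [add_self_zmod_two]
  | succ j hij ih =>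
    have hmem : j ∈ Finset.Ico i (j + 1) := Finset.mem_Ico.2 ⟨hij, j.lt_succ_self⟩
    have hmem' : j ∈ Finset.Icc i (j + 1) := Finset.mem_Icc.2 ⟨hij, j.le_succ⟩
    have hmem'' : j + 1 ∈ Finset.Icc i (j + 1) := Finset.mem_Icc.2 ⟨hij.trans j.le_succ, le_rfl⟩
    have hsub : Finset.Ico i j ⊆ Finset.Ico i (j + 1) := Finset.Ico_subset_Ico_right j.le_succ
    have hsub' : Finset.Icc i j ⊆ Finset.Icc i (j + 1) := Finset.Icc_subset_Icc_right j.le_succ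
    rw [Finset.sum_Ico_succ_top hij, ih (fun k hk => hp k (hsub hk)) (fun k hk => hz k (hsub' hk))
      (fun k hk => hw k (hsub' hk)) (fun k hk => h k (hsub hk)),
      below_add_below (hp j hmem) hzw (hz j hmem') (hz _ hmem'') (hw j hmem') (hw _ hmem'')
        (h j hmem)]
    -- The intermediate corner `p j` is counted once by each adjacent part of the path.
    linear_combination add_self_zmod_two (above z w (p j))

/-! ### Turns at a corner -/

/-- The slope of the line through `a` and `b`. -/
def lineSlope (a b : Plane) : ℝ := (b.2 - a.2) / (b.1 - a.1)

/-- The path `a b c` turns back at `b` in horizontal direction, and `b c` leaves `b` below `b a`. -/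
def TurnsBelow (a b c : Plane) : Prop :=
  (b.1 < a.1 ∧ b.1 < c.1 ∧ lineSlope b c < lineSlope b a) ∨
    (a.1 < b.1 ∧ c.1 < b.1 ∧ lineSlope b a < lineSlope b c)

lemma lineAt_eq (a b : Plane) (t : ℝ) : lineAt a b t = a.2 + (t - a.1) * lineSlope a b := rfl

lemma snd_eq {a b : Plane} (h : a.1 ≠ b.1) : b.2 = a.2 + (b.1 - a.1) * lineSlope a b := by
  rw [← lineAt_eq, lineAt_snd h]

/-- If the path turns back at `b`, exactly one of `a`, `c` has its abscissa in the range of the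
other side, and comparing heights there is comparing slopes at `b`. If it does not turn back, both
terms vanish. -/
lemma above_add_below_eq_turnsBelow {a b c : Plane} (hab : a.1 ≠ b.1) (hbc : b.1 ≠ c.1)
    (hac : a.1 ≠ c.1) : above a b c + below b c a = ind (TurnsBelow a b c) := by
  rw [above_comm hab]
  have ha := snd_eq hab.symm
  have hc := snd_eq hbc
  unfold above below
  rw [lineAt_eq, lineAt_eq, ha, hc]
  rcases lt_or_gt_of_ne hab with h | h <;> rcases lt_or_gt_of_ne hbc with h' | h'
  · rw [ind_false, ind_false, ind_false, add_zero]
    · unfold TurnsBelow; rintro (⟨_, _⟩ | ⟨_, _⟩) <;> linarith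
    · unfold Between; rintro ⟨⟨_, _⟩ | ⟨_, _⟩, _⟩ <;> linarith
    · unfold Between; rintro ⟨⟨_, _⟩ | ⟨_, _⟩, _⟩ <;> linarith
  · rcases lt_or_gt_of_ne hac with h'' | h''
    · rw [ind_false (p := Between b.1 c.1 a.1 ∧ _), add_zero]
      · apply ind_congr
        unfold Between TurnsBelow
        constructor
        · rintro ⟨_, h3⟩
          exact Or.inr ⟨h, h', by nlinarith⟩
        · rintro (⟨_, _⟩ | ⟨_, _, _⟩)
          · linarith
          · exact ⟨Or.inr ⟨h'', h'⟩, by nlinarith⟩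
      · unfold Between; rintro ⟨⟨_, _⟩ | ⟨_, _⟩, _⟩ <;> linarith
    · rw [ind_false (p := Between b.1 a.1 c.1 ∧ _), zero_add]
      · apply ind_congr
        unfold Between TurnsBelow
        constructor
        · rintro ⟨_, h3⟩
          exact Or.inr ⟨h, h', by nlinarith⟩
        · rintro (⟨_, _⟩ | ⟨_, _, _⟩)
          · linarith
          · exact ⟨Or.inr ⟨h'', h⟩, by nlinarith⟩
      · unfold Between; rintro ⟨⟨_, _⟩ | ⟨_, _⟩, _⟩ <;> linarith
  · rcases lt_or_gt_of_ne hac with h'' | h''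
    · rw [ind_false (p := Between b.1 a.1 c.1 ∧ _), zero_add]
      · apply ind_congr
        unfold Between TurnsBelow
        constructor
        · rintro ⟨_, h3⟩
          exact Or.inl ⟨h, h', by nlinarith⟩
        · rintro (⟨_, _, _⟩ | ⟨_, _, _⟩)
          · exact ⟨Or.inl ⟨h, h''⟩, by nlinarith⟩
          · linarith
      · unfold Between; rintro ⟨⟨_, _⟩ | ⟨_, _⟩, _⟩ <;> linarith
    · rw [ind_false (p := Between b.1 c.1 a.1 ∧ _), add_zero]
      · apply ind_congr
        unfold Between TurnsBelow
        constructor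
        · rintro ⟨_, h3⟩
          exact Or.inl ⟨h, h', by nlinarith⟩
        · rintro (⟨_, _, _⟩ | ⟨_, _, _⟩)
          · exact ⟨Or.inl ⟨h', h''⟩, by nlinarith⟩
          · linarith
      · unfold Between; rintro ⟨⟨_, _⟩ | ⟨_, _⟩, _⟩ <;> linarith
  · rw [ind_false, ind_false, ind_false, add_zero]
    · unfold TurnsBelow; rintro (⟨_, _⟩ | ⟨_, _⟩) <;> linarith
    · unfold Between; rintro ⟨⟨_, _⟩ | ⟨_, _⟩, _⟩ <;> linarith
    · unfold Between; rintro ⟨⟨_, _⟩ | ⟨_, _⟩, _⟩ <;> linarith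

lemma turnsBelow_congr {a b c z : Plane} (hl : z.1 < b.1 ↔ a.1 < b.1) (hr : b.1 < z.1 ↔ b.1 < a.1)
    (hs : lineSlope b z = lineSlope b a) : TurnsBelow z b c ↔ TurnsBelow a b c := by
  unfold TurnsBelow
  rw [hl, hr, hs]

/-- Of the two sides at a corner where the path turns back, one is above the other. -/
lemma turnsBelow_add_turnsBelow {a b c : Plane} (hab : a.1 ≠ b.1) (hbc : b.1 ≠ c.1)
    (hs : lineSlope b a ≠ lineSlope b c) :
    ind (TurnsBelow a b c) + ind (TurnsBelow c b a) = ind (a.1 < b.1) + ind (b.1 < c.1) := by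
  have h11 : (1 : ZMod 2) + 1 = 0 := rfl
  rcases lt_or_gt_of_ne hab with h | h <;> rcases lt_or_gt_of_ne hbc with h' | h' <;>
    rcases lt_or_gt_of_ne hs with h'' | h'' <;>
    simp [ind, TurnsBelow, h, h', h'', not_lt.2 h.le, not_lt.2 h'.le, not_lt.2 h''.le, h11]

/-! ### Parities of edges below the points of a simple polygon -/

/-- The corners `p 0, …, p (n - 1)` of a simple polygon, continued periodically, if they have
distinct abscissas and no three consecutive ones are collinear. -/
structure SweepPolygon (n : ℕ) (p : ℕ → Plane) : Prop where
  three_le : 3 ≤ n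
  periodic : ∀ i, p (i + n) = p i
  fst_inj : ∀ i j, (p i).1 = (p j).1 → i ≡ j [MOD n]
  disjoint : ∀ i j, i + 1 < j → j + 1 < i + n →
    Disjoint (segment ℝ (p i) (p (i + 1))) (segment ℝ (p j) (p (j + 1)))
  consecutive : ∀ i, segment ℝ (p i) (p (i + 1)) ∩ segment ℝ (p (i + 1)) (p (i + 2)) = {p (i + 1)}
  slope_ne : ∀ i, lineSlope (p (i + 1)) (p i) ≠ lineSlope (p (i + 1)) (p (i + 2))

lemma fst_mem_uIcc_of_mem_segment {a b z : Plane} (h : z ∈ segment ℝ a b) :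
    z.1 ∈ Set.uIcc a.1 b.1 := by
  rw [← segment_eq_uIcc]
  have := Set.mem_image_of_mem (LinearMap.fst ℝ ℝ ℝ).toAffineMap h
  rw [image_segment] at this
  exact this

lemma lineSlope_symm (a b : Plane) : lineSlope a b = lineSlope b a := by
  unfold lineSlope
  rw [← neg_sub b.2 a.2, ← neg_sub b.1 a.1, neg_div_neg_eq]

lemma lineSlope_lineAt {a b : Plane} {t : ℝ} (h : t ≠ a.1) :
    lineSlope a (t, lineAt a b t) = lineSlope a b := by
  have : t - a.1 ≠ 0 := sub_ne_zero.2 h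
  unfold lineSlope lineAt
  simp only
  field_simp
  ring

/-- The parity of the number of edges below the corner `p i`. -/
def cornerParity (n : ℕ) (p : ℕ → Plane) (i : ℕ) : ZMod 2 :=
  ∑ k ∈ Finset.Ico (i + 1) (i + n - 1), below (p k) (p (k + 1)) (p i)

/-- The point with abscissa `t` on the line through the edge from `p i` to `p (i + 1)`. -/
def edgePoint (p : ℕ → Plane) (i : ℕ) (t : ℝ) : Plane :=
  (t, lineAt (p i) (p (i + 1)) t)

/-- The parity of the number of edges below the point with abscissa `t` on the edge from `p i` to
`p (i + 1)`. -/
def edgeParity (n : ℕ) (p : ℕ → Plane) (i : ℕ) (t : ℝ) : ZMod 2 :=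
  ∑ k ∈ Finset.Ico (i + 1) (i + n), below (p k) (p (k + 1)) (edgePoint p i t)

/-- The abscissa `t` is in the range of the edge from `p i` to `p (i + 1)`, and not that of a
corner. -/
def GenericOn (p : ℕ → Plane) (i : ℕ) (t : ℝ) : Prop :=
  Between (p i).1 (p (i + 1)).1 t ∧ ∀ k, (p k).1 ≠ t

namespace SweepPolygon

variable {n : ℕ} {p : ℕ → Plane}

lemma shift (S : SweepPolygon n p) (m : ℕ) : SweepPolygon n (fun i => p (m + i)) where
  three_le := S.three_le
  periodic i := by rw [← add_assoc]; exact S.periodic _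
  fst_inj i j h := Nat.ModEq.add_left_cancel' m (S.fst_inj _ _ h)
  disjoint i j h h' := S.disjoint (m + i) (m + j) (by omega) (by omega)
  consecutive i := S.consecutive (m + i)
  slope_ne i := S.slope_ne (m + i)

lemma periodic_mul (S : SweepPolygon n p) (i k : ℕ) : p (i + k * n) = p i := by
  induction k with
  | zero => simp
  | succ k ih => rw [Nat.succ_mul, ← add_assoc, S.periodic, ih]

lemma eq_of_modEq (S : SweepPolygon n p) {i j : ℕ} (h : i ≡ j [MOD n]) : p i = p j := by
  rw [← Nat.mod_add_div i n, ← Nat.mod_add_div j n, mul_comm, S.periodic_mul, mul_comm n,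
    S.periodic_mul, h]

lemma fst_ne (S : SweepPolygon n p) {i j : ℕ} (h : i < j) (h' : j < i + n) : (p i).1 ≠ (p j).1 := by
  intro he
  have h1 := (Nat.modEq_iff_dvd' h.le).1 (S.fst_inj i j he)
  have := Nat.le_of_dvd (by omega) h1
  omega

lemma fst_ne_succ (S : SweepPolygon n p) (i : ℕ) : (p i).1 ≠ (p (i + 1)).1 :=
  S.fst_ne (Nat.lt_succ_self i) (by have := S.three_le; omega)

/-- Consecutive edges, the first one cut off before its end. -/
lemma disjoint_succ_of_fst (S : SweepPolygon n p) {i : ℕ} {z : Plane}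
    (hz : z ∈ segment ℝ (p i) (p (i + 1)))
    (hz' : z.1 ≠ (p (i + 1)).1) :
    Disjoint (segment ℝ z (p i)) (segment ℝ (p (i + 1)) (p (i + 2))) := by
  rw [Set.disjoint_left]
  intro w hw hw'
  have hsub : segment ℝ z (p i) ⊆ segment ℝ (p i) (p (i + 1)) :=
    (convex_segment _ _).segment_subset hz (left_mem_segment ℝ _ _)
  have hmem : w ∈ segment ℝ (p i) (p (i + 1)) ∩ segment ℝ (p (i + 1)) (p (i + 2)) :=
    ⟨hsub hw, hw'⟩
  rw [S.consecutive, Set.mem_singleton_iff] at hmem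
  have h1 := fst_mem_uIcc_of_mem_segment hw
  have h2 := fst_mem_uIcc_of_mem_segment hz
  rw [hmem] at h1
  rw [Set.mem_uIcc] at h1 h2
  rcases h1 with h1 | h1 <;> rcases h2 with h2 | h2 <;>
    exact hz' (le_antisymm (by linarith) (by linarith))

/-- Consecutive edges, the second one cut off before its start. -/
lemma disjoint_succ_of_snd (S : SweepPolygon n p) {i : ℕ} {z : Plane}
    (hz : z ∈ segment ℝ (p (i + 1)) (p (i + 2)))
    (hz' : z.1 ≠ (p (i + 1)).1) :
    Disjoint (segment ℝ (p i) (p (i + 1))) (segment ℝ z (p (i + 2))) := by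
  rw [Set.disjoint_left]
  intro w hw hw'
  have hsub : segment ℝ z (p (i + 2)) ⊆ segment ℝ (p (i + 1)) (p (i + 2)) :=
    (convex_segment _ _).segment_subset hz (right_mem_segment ℝ _ _)
  have hmem : w ∈ segment ℝ (p i) (p (i + 1)) ∩ segment ℝ (p (i + 1)) (p (i + 2)) :=
    ⟨hw, hsub hw'⟩
  rw [S.consecutive, Set.mem_singleton_iff] at hmem
  have h1 := fst_mem_uIcc_of_mem_segment hw'
  have h2 := fst_mem_uIcc_of_mem_segment hz
  rw [hmem] at h1
  rw [Set.mem_uIcc] at h1 h2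
  rcases h1 with h1 | h1 <;> rcases h2 with h2 | h2 <;>
    exact hz' (le_antisymm (by linarith) (by linarith))

lemma edgePoint_mem (S : SweepPolygon n p) {i : ℕ} {t : ℝ} (ht : GenericOn p i t) :
    edgePoint p i t ∈ segment ℝ (p i) (p (i + 1)) :=
  lineAt_mem_segment (S.fst_ne_succ i) (mem_uIcc_of_between ht.1)

/-- The segment from `z` to the end of its edge is disjoint from the path from `p (i + 2)` round to
`p i`, so crossing parity compares the two counts. The edge leaving `p (i + 1)`, counted only at
`z`, supplies the other half of the turn. -/
lemma edgeParity_add_cornerParity_end (S : SweepPolygon n p) {i : ℕ} {t : ℝ}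
    (ht : GenericOn p i t) :
    edgeParity n p i t + cornerParity n p (i + 1) =
      ind (TurnsBelow (p i) (p (i + 1)) (p (i + 2))) := by
  have hn := S.three_le
  set z := edgePoint p i t with hz
  have hz1 : z.1 = t := rfl
  have hzm : z ∈ segment ℝ (p i) (p (i + 1)) := S.edgePoint_mem ht
  have hsub : segment ℝ z (p (i + 1)) ⊆ segment ℝ (p i) (p (i + 1)) :=
    (convex_segment _ _).segment_subset hzm (right_mem_segment ℝ _ _)
  have hzi : z.1 ≠ (p i).1 := (ht.2 i).symm
  have hzi1 : z.1 ≠ (p (i + 1)).1 := (ht.2 _).symm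
  have key := sum_below_add_below (p := p) (z := z) (w := p (i + 1)) hzi1
    (i := i + 2) (j := i + n) (by omega) (fun k _ => S.fst_ne_succ k) (fun k _ => ht.2 k)
    (fun k hk => (S.fst_ne (by have := Finset.mem_Icc.1 hk; omega)
      (by have := Finset.mem_Icc.1 hk; omega)).symm)
    (fun k hk => by
      rw [Finset.mem_Ico] at hk
      rcases Nat.lt_or_ge (k + 1) (i + n) with h | h
      · exact (S.disjoint i k (by omega) h).symm.mono_right hsub
      -- The last edge of the path ends in `p i` and is adjacent to the edge of `z`; it is disjoint
      -- from the cut segment because `z` is not `p i`.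
      · obtain ⟨m, rfl⟩ : ∃ m, n = m + 1 := ⟨n - 1, by omega⟩
        have hk' : k = i + m := by omega
        have h0 : p (i + m + 1) = p i := S.periodic i
        have h1 : p (i + m + 2) = p (i + 1) := by
          rw [← S.periodic (i + 1)]; congr 1; omega
        have := S.disjoint_succ_of_snd (i := i + m) (z := z) (by rw [h0, h1]; exact hzm)
          (by rw [h0]; exact hzi)
        rw [h1] at this
        rw [hk']
        exact this)
  -- The path ends in `p i`, which is on the far side of `z` from `p (i + 1)`.
  have h0 : above z (p (i + 1)) (p (i + n)) = 0 := by
    rw [S.periodic]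
    refine ind_false ?_
    rintro ⟨h, -⟩
    have := ht.1
    rw [hz1] at h
    unfold Between at h this
    rcases h with h | h <;> rcases this with h' | h' <;> linarith [h.1, h.2, h'.1, h'.2]
  have h1 : ind (TurnsBelow (p i) (p (i + 1)) (p (i + 2))) =
      ind (TurnsBelow z (p (i + 1)) (p (i + 2))) := by
    refine ind_congr (turnsBelow_congr ?_ ?_ ?_).symm
    · rw [hz1]
      have := ht.1
      unfold Between at this
      rcases this with h' | h' <;> constructor <;> intro <;> linarith [h'.1, h'.2]
    · rw [hz1]
      have := ht.1
      unfold Between at this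
      rcases this with h' | h' <;> constructor <;> intro <;> linarith [h'.1, h'.2]
    · rw [hz, edgePoint, lineAt_symm (S.fst_ne_succ i)]
      exact lineSlope_lineAt (ht.2 _).symm
  rw [h1, ← above_add_below_eq_turnsBelow hzi1 (S.fst_ne_succ _) (ht.2 _).symm]
  rw [h0, add_zero, Finset.sum_add_distrib] at key
  have hc : cornerParity n p (i + 1) =
      ∑ k ∈ Finset.Ico (i + 2) (i + n), below (p k) (p (k + 1)) (p (i + 1)) := by
    unfold cornerParity
    congr 2; omega
  unfold edgeParity
  rw [hc, Finset.sum_eq_sum_Ico_succ_bot (by omega)]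
  linear_combination key

/-- The mirror image of `edgeParity_add_cornerParity_end`; now the edge arriving at `p (i + 1)` is
the one counted only at `z`, as the last term of the sum. -/
lemma edgeParity_add_cornerParity_start (S : SweepPolygon n p) {i : ℕ} {t : ℝ}
    (ht : GenericOn p (i + 1) t) :
    edgeParity n p (i + 1) t + cornerParity n p (i + 1) =
      ind (TurnsBelow (p (i + 2)) (p (i + 1)) (p i)) := by
  have hn := S.three_le
  set z := edgePoint p (i + 1) t with hz
  have hz1 : z.1 = t := rfl
  have hzm : z ∈ segment ℝ (p (i + 1)) (p (i + 2)) := S.edgePoint_mem ht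
  have hsub : segment ℝ z (p (i + 1)) ⊆ segment ℝ (p (i + 1)) (p (i + 2)) :=
    (convex_segment _ _).segment_subset hzm (left_mem_segment ℝ _ _)
  have hzi : z.1 ≠ (p (i + 2)).1 := (ht.2 _).symm
  have hzi1 : z.1 ≠ (p (i + 1)).1 := (ht.2 _).symm
  have key := sum_below_add_below (p := p) (z := z) (w := p (i + 1)) hzi1
    (i := i + 2) (j := i + n) (by omega) (fun k _ => S.fst_ne_succ k) (fun k _ => ht.2 k)
    (fun k hk => (S.fst_ne (by have := Finset.mem_Icc.1 hk; omega)
      (by have := Finset.mem_Icc.1 hk; omega)).symm)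
    (fun k hk => by
      rw [Finset.mem_Ico] at hk
      rcases Nat.lt_or_ge (i + 2) k with h | h
      · exact (S.disjoint (i + 1) k (by omega) (by omega)).symm.mono_right hsub
      · have hk' : k = i + 2 := by omega
        rw [hk']
        exact (S.disjoint_succ_of_fst (i := i + 1) hzm hzi).symm)
  have h0 : above z (p (i + 1)) (p (i + 2)) = 0 := by
    refine ind_false ?_
    rintro ⟨h, -⟩
    have := ht.1
    rw [hz1] at h
    unfold Between at h this
    rcases h with h | h <;> rcases this with h' | h' <;> linarith [h.1, h.2, h'.1, h'.2]
  have h1 : ind (TurnsBelow (p (i + 2)) (p (i + 1)) (p i)) =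
      ind (TurnsBelow z (p (i + 1)) (p i)) := by
    refine ind_congr (turnsBelow_congr ?_ ?_ ?_).symm
    · rw [hz1]
      have := ht.1
      unfold Between at this
      rcases this with h' | h' <;> constructor <;> intro <;> linarith [h'.1, h'.2]
    · rw [hz1]
      have := ht.1
      unfold Between at this
      rcases this with h' | h' <;> constructor <;> intro <;> linarith [h'.1, h'.2]
    · exact lineSlope_lineAt (ht.2 _).symm
  rw [h1, ← above_add_below_eq_turnsBelow hzi1 (S.fst_ne_succ _).symm (ht.2 _).symm]
  rw [h0, zero_add, Finset.sum_add_distrib, S.periodic] at key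
  have hc : cornerParity n p (i + 1) =
      ∑ k ∈ Finset.Ico (i + 2) (i + n), below (p k) (p (k + 1)) (p (i + 1)) := by
    unfold cornerParity
    congr 2; omega
  have he : i + 1 + n = i + n + 1 := by omega
  have hp : p (i + n + 1) = p (i + 1) := by rw [← S.periodic (i + 1), he]
  unfold edgeParity
  rw [hc, he, Finset.sum_Ico_succ_top (by omega), S.periodic, hp, ← hz,
    below_comm (S.fst_ne_succ i)]
  linear_combination key

/-- The parity of the number of edges below a point of an edge, corrected by the horizontal
direction of the edge, is the same along two consecutive edges. -/
lemma edgeParity_succ (S : SweepPolygon n p) {i : ℕ} {t t' : ℝ} (ht : GenericOn p i t)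
    (ht' : GenericOn p (i + 1) t') :
    edgeParity n p (i + 1) t' + ind ((p (i + 1)).1 < (p (i + 2)).1) =
      edgeParity n p i t + ind ((p i).1 < (p (i + 1)).1) := by
  have h1 := S.edgeParity_add_cornerParity_end ht
  have h2 := S.edgeParity_add_cornerParity_start ht'
  have h3 := turnsBelow_add_turnsBelow (S.fst_ne_succ i) (S.fst_ne_succ (i + 1)) (S.slope_ne i)
  have h0 : (2 : ZMod 2) = 0 := rfl
  linear_combination h1 + h2 + h3 + (ind ((p (i + 1)).1 < (p (i + 2)).1) - edgeParity n p i t -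
    cornerParity n p (i + 1)) * h0

lemma exists_genericOn (S : SweepPolygon n p) (i : ℕ) : ∃ t, GenericOn p i t := by
  have hfin : (Set.range fun k => (p k).1).Finite := by
    refine ((Finset.range n).image fun k => (p k).1).finite_toSet.subset ?_
    rintro _ ⟨k, rfl⟩
    rw [Finset.coe_image]
    refine ⟨k % n, by simpa using Nat.mod_lt k (by have := S.three_le; omega), ?_⟩
    simp only
    rw [S.eq_of_modEq (Nat.mod_modEq k n)]
  have hne : min (p i).1 (p (i + 1)).1 < max (p i).1 (p (i + 1)).1 := min_lt_max.2 (S.fst_ne_succ i)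
  obtain ⟨t, ht, ht'⟩ := (Set.Ioo_infinite hne).exists_notMem_finite hfin
  refine ⟨t, ?_, fun k hk => ht' ⟨k, hk⟩⟩
  unfold Between
  rcases lt_or_gt_of_ne (S.fst_ne_succ i) with h | h
  · rw [min_eq_left h.le, max_eq_right h.le] at ht
    exact Or.inl ht
  · rw [min_eq_right h.le, max_eq_left h.le] at ht
    exact Or.inr ht

/-- The constant is the orientation: edges with nothing below them run to the left for `κ = 0` and
to the right for `κ = 1`. -/
lemma exists_edgeParity_eq (S : SweepPolygon n p) :
    ∃ κ : ZMod 2, ∀ i t, GenericOn p i t →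
      edgeParity n p i t + ind ((p i).1 < (p (i + 1)).1) = κ := by
  obtain ⟨t₁, h₁⟩ := S.exists_genericOn 1
  have hall : ∀ i t, GenericOn p (i + 1) t →
      edgeParity n p (i + 1) t + ind ((p (i + 1)).1 < (p (i + 2)).1) =
      edgeParity n p 1 t₁ + ind ((p 1).1 < (p 2).1) := by
    intro i
    induction i with
    | zero =>
      intro t ht
      obtain ⟨t₀, h₀⟩ := S.exists_genericOn 0
      rw [S.edgeParity_succ h₀ ht, S.edgeParity_succ h₀ h₁]
    | succ i ih =>
      intro t ht
      obtain ⟨t₀, h₀⟩ := S.exists_genericOn (i + 1)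
      rw [S.edgeParity_succ h₀ ht, ih t₀ h₀]
  refine ⟨edgeParity n p 1 t₁ + ind ((p 1).1 < (p 2).1), fun i t ht => ?_⟩
  obtain ⟨t', h'⟩ := S.exists_genericOn (i + 1)
  rw [← S.edgeParity_succ ht h']
  exact hall i t' h'

end SweepPolygon

/-! ### The edge parity and the sign of the area -/

lemma integral_lineAt {a b : Plane} (h : a.1 ≠ b.1) :
    ∫ t in a.1..b.1, lineAt a b t = (b.1 - a.1) * (a.2 + b.2) / 2 := by
  have h1 : b.1 - a.1 ≠ 0 := sub_ne_zero.2 h.symm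
  unfold lineAt
  rw [intervalIntegral.integral_add (by simp) (Continuous.intervalIntegrable (by fun_prop) _ _),
    intervalIntegral.integral_const, intervalIntegral.integral_mul_const,
    intervalIntegral.integral_sub (by simp) (by simp), integral_id,
    intervalIntegral.integral_const, smul_eq_mul, smul_eq_mul]
  field_simp
  ring

lemma sum_Ico_of_periodic {M : Type*} [AddCommGroup M] {n : ℕ} {f : ℕ → M}
    (hf : ∀ k, f (k + n) = f k) (i : ℕ) :
    ∑ k ∈ Finset.Ico i (i + n), f k = ∑ k ∈ Finset.range n, f k := by
  induction i with
  | zero => rw [zero_add, Finset.range_eq_Ico]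
  | succ i ih =>
    rw [← ih]
    have h1 := Finset.sum_Ico_succ_top (show i ≤ i + n by omega) f
    have h2 := Finset.sum_eq_sum_Ico_succ_bot (show i < i + n + 1 by omega) f
    rw [h1, hf i, add_comm] at h2
    rw [show i + 1 + n = i + n + 1 by omega]
    exact (add_left_cancel h2).symm

open Classical in
/-- An alternating sum of increasing numbers. -/
lemma alternating_sum_le {ι : Type*} (h : ι → ℝ) (E : Finset ι) :
    Set.InjOn h E → ∀ M, (∀ i ∈ E, h i ≤ M) →
      ∑ i ∈ E, (-1 : ℝ) ^ (E.filter fun j => h j < h i).card * h i ≤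
        if Even E.card then 0 else M := by
  -- A new largest element leaves the ranks of the others unchanged, and its own rank is the number
  -- of the others. The induction hypothesis is used with its value as the bound `M`.
  induction E using Finset.induction_on_max_value h with
  | empty => simp
  | insert a s ha hmax ih =>
    intro hinj M hM
    have hlt : ∀ x ∈ s, h x < h a := fun x hx => lt_of_le_of_ne (hmax x hx) fun he =>
      ha (hinj (by simp [hx]) (by simp) he ▸ hx)
    rw [Finset.sum_insert ha, Finset.card_insert_of_notMem ha]
    have h1 : ((insert a s).filter fun j => h j < h a) = s := by
      rw [Finset.filter_insert, if_neg (lt_irrefl _), Finset.filter_true_of_mem hlt]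
    have h2 : ∑ x ∈ s, (-1 : ℝ) ^ ((insert a s).filter fun j => h j < h x).card * h x =
        ∑ x ∈ s, (-1 : ℝ) ^ (s.filter fun j => h j < h x).card * h x := by
      refine Finset.sum_congr rfl fun x hx => ?_
      rw [Finset.filter_insert, if_neg (hlt x hx).not_gt]
    rw [h1, h2]
    have ih' := ih (hinj.mono (by simp)) (h a) hmax
    have haM := hM a (Finset.mem_insert_self a s)
    rcases Nat.even_or_odd s.card with he | he
    · rw [if_pos he] at ih'
      rw [he.neg_one_pow, if_neg (by simpa [Nat.even_add_one] using he)]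
      linarith
    · rw [if_neg (Nat.not_even_iff_odd.2 he)] at ih'
      rw [he.neg_one_pow, if_pos (by simpa [Nat.even_add_one] using he)]
      linarith

lemma sum_ind_eq_card {ι : Type*} (s : Finset ι) (P : ι → Prop) [DecidablePred P] :
    ∑ k ∈ s, ind (P k) = ((s.filter P).card : ZMod 2) := by
  rw [← Finset.sum_boole]
  refine Finset.sum_congr rfl fun k _ => ?_
  by_cases h : P k <;> simp [ind, h]

namespace SweepPolygon

variable {n : ℕ} {p : ℕ → Plane}

/-- Distinct edges meet only in common corners, whose abscissas differ from `t`. -/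
lemma lineAt_ne (S : SweepPolygon n p) {i k : ℕ} (hi : i < n) (hik : i < k) (hk : k < n) {t : ℝ}
    (ht : GenericOn p i t)
    (ht' : GenericOn p k t) : lineAt (p i) (p (i + 1)) t ≠ lineAt (p k) (p (k + 1)) t := by
  intro he
  have h1 := S.edgePoint_mem ht
  have h2 := S.edgePoint_mem ht'
  have he' : edgePoint p i t = edgePoint p k t := by rw [edgePoint, edgePoint, he]
  rw [← he'] at h2
  rcases Nat.lt_or_ge (i + 1) k with h3 | h3
  · rcases Nat.lt_or_ge (k + 1) (i + n) with h4 | h4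
    · exact Set.disjoint_left.1 (S.disjoint i k h3 h4) h1 h2
    -- The edges `n - 1` and `0` are adjacent although their indices are far apart.
    · have hi0 : i = 0 := by omega
      have hk1 : k + 1 = n := by omega
      subst hi0
      have h0 : p (k + 1) = p 0 := by rw [hk1]; simpa using S.periodic 0
      have h0' : p (k + 2) = p 1 := by
        rw [show k + 2 = 1 + n by omega]; exact S.periodic 1
      have hc := S.consecutive k
      rw [h0, h0'] at hc
      have hm : edgePoint p 0 t ∈ ({p 0} : Set Plane) := hc ▸ ⟨h0 ▸ h2, h1⟩
      exact ht.2 0 (congrArg Prod.fst (Set.mem_singleton_iff.1 hm)).symm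
  · have hk1 : k = i + 1 := by omega
    subst hk1
    have hm : edgePoint p i t ∈ ({p (i + 1)} : Set Plane) := S.consecutive i ▸ ⟨h1, h2⟩
    exact ht.2 _ (congrArg Prod.fst (Set.mem_singleton_iff.1 hm)).symm

lemma edgeParity_eq_sum_range (S : SweepPolygon n p) (i : ℕ) (t : ℝ) :
    edgeParity n p i t = ∑ k ∈ Finset.range n, below (p k) (p (k + 1)) (edgePoint p i t) := by
  have hn := S.three_le
  rw [← sum_Ico_of_periodic (n := n) _ i, Finset.sum_eq_sum_Ico_succ_bot (by omega)]
  · rw [edgeParity]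
    have : below (p i) (p (i + 1)) (edgePoint p i t) = 0 :=
      ind_false fun h => lt_irrefl _ h.2
    rw [this, zero_add]
  · intro k
    rw [show k + n + 1 = k + 1 + n by omega, S.periodic, S.periodic]

/-- Over a generic abscissa, the edges alternate in direction from the bottom to the top. -/
lemma sum_height_nonneg (S : SweepPolygon n p) (hκ : ∀ i t, GenericOn p i t →
      edgeParity n p i t + ind ((p i).1 < (p (i + 1)).1) = 0) {t : ℝ} (ht : ∀ k, (p k).1 ≠ t) :
    0 ≤ ∑ i ∈ Finset.range n, (if (p i).1 ≤ (p (i + 1)).1 then (1 : ℝ) else -1) *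
      (Set.uIoc (p i).1 (p (i + 1)).1).indicator (lineAt (p i) (p (i + 1))) t := by
  classical
  set E := (Finset.range n).filter fun i => Between (p i).1 (p (i + 1)).1 t with hE
  set h : ℕ → ℝ := fun i => lineAt (p i) (p (i + 1)) t with hh
  have hmem : ∀ i, t ∈ Set.uIoc (p i).1 (p (i + 1)).1 ↔ Between (p i).1 (p (i + 1)).1 t := by
    intro i
    rw [Set.mem_uIoc]
    unfold Between
    have h1 := lt_or_gt_of_ne (ht i)
    have h2 := lt_or_gt_of_ne (ht (i + 1))
    constructor
    · rintro (h | h)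
      · exact Or.inl ⟨h.1, lt_of_le_of_ne h.2 (ht (i + 1)).symm⟩
      · exact Or.inr ⟨h.1, lt_of_le_of_ne h.2 (ht i).symm⟩
    · rintro (h | h)
      · exact Or.inl ⟨h.1, h.2.le⟩
      · exact Or.inr ⟨h.1, h.2.le⟩
  have hgen : ∀ i ∈ E, GenericOn p i t := fun i hi => ⟨(Finset.mem_filter.1 hi).2, ht⟩
  have hinj : Set.InjOn h E := by
    intro i hi k hk he
    have hi' := Finset.mem_range.1 (Finset.mem_filter.1 hi).1
    have hk' := Finset.mem_range.1 (Finset.mem_filter.1 hk).1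
    by_contra hne
    rcases lt_or_gt_of_ne hne with hlt | hlt
    · exact S.lineAt_ne hi' hlt hk' (hgen i hi) (hgen k hk) he
    · exact S.lineAt_ne hk' hlt hi' (hgen k hk) (hgen i hi) he.symm
  -- A closed path changes sides of the vertical line an even number of times.
  have heven : Even E.card := by
    rw [← ZMod.natCast_eq_zero_iff_even, hE, ← sum_ind_eq_card]
    rw [Finset.sum_congr rfl fun i _ => ind_between (ht i) (ht (i + 1)), Finset.sum_add_distrib]
    have h1 := sum_Ico_of_periodic (n := n) (f := fun k => ind ((p k).1 < t))
      (fun k => by rw [S.periodic]) 1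
    rw [Finset.sum_Ico_eq_sum_range, Nat.add_sub_cancel_left] at h1
    simp only [add_comm 1] at h1
    rw [h1, add_self_zmod_two]
  obtain ⟨M, hM⟩ : ∃ M, ∀ i ∈ E, h i ≤ M := by
    obtain ⟨M, hM⟩ := (E.image h).bddAbove
    exact ⟨M, fun i hi => hM (by simpa using ⟨i, hi, rfl⟩)⟩
  have halt := alternating_sum_le h E hinj M hM
  rw [if_pos heven] at halt
  -- The parity of the rank of an edge among those over `t` is its edge parity, so `hκ` turns
  -- directions into alternating signs, starting with `-1` at the bottom.
  have hterm : ∀ i ∈ E, (if (p i).1 ≤ (p (i + 1)).1 then (1 : ℝ) else -1) =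
      -(-1) ^ (E.filter fun j => h j < h i).card := by
    intro i hi
    have hpar := hκ i t (hgen i hi)
    rw [S.edgeParity_eq_sum_range] at hpar
    unfold below at hpar
    rw [sum_ind_eq_card] at hpar
    have hcard : (E.filter fun j => h j < h i) = (Finset.range n).filter fun k =>
        Between (p k).1 (p (k + 1)).1 (edgePoint p i t).1 ∧
          lineAt (p k) (p (k + 1)) (edgePoint p i t).1 < (edgePoint p i t).2 := by
      rw [hE, Finset.filter_filter]
      rfl
    rw [← hcard] at hpar
    rcases lt_or_gt_of_ne (S.fst_ne_succ i) with hlt | hlt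
    · rw [if_pos hlt.le]
      rw [ind_true hlt] at hpar
      have : Odd (E.filter fun j => h j < h i).card := by
        rw [← Nat.not_even_iff_odd, ← ZMod.natCast_eq_zero_iff_even]
        intro h0
        rw [h0] at hpar
        exact one_ne_zero ((zero_add _).symm.trans hpar)
      rw [this.neg_one_pow, neg_neg]
    · rw [if_neg hlt.not_ge]
      rw [ind_false hlt.not_gt, add_zero, ZMod.natCast_eq_zero_iff_even] at hpar
      rw [hpar.neg_one_pow]
  have hsum : ∑ i ∈ Finset.range n, (if (p i).1 ≤ (p (i + 1)).1 then (1 : ℝ) else -1) *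
      (Set.uIoc (p i).1 (p (i + 1)).1).indicator (lineAt (p i) (p (i + 1))) t =
      ∑ i ∈ E, -((-1) ^ (E.filter fun j => h j < h i).card * h i) := by
    rw [hE, Finset.sum_filter]
    refine Finset.sum_congr rfl fun i hi => ?_
    by_cases hB : Between (p i).1 (p (i + 1)).1 t
    · rw [if_pos hB, Set.indicator_of_mem ((hmem i).2 hB),
        hterm i (Finset.mem_filter.2 ⟨hi, hB⟩), neg_mul]
    · rw [if_neg hB, Set.indicator_of_notMem (fun hc => hB ((hmem i).1 hc)), mul_zero]
  rw [hsum, Finset.sum_neg_distrib]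
  linarith

/-- If the lowest edges run to the left, then the area is not positive. -/
lemma area_nonpos (S : SweepPolygon n p) (hκ : ∀ i t, GenericOn p i t →
      edgeParity n p i t + ind ((p i).1 < (p (i + 1)).1) = 0) :
    ∑ i ∈ Finset.range n, ((p i).1 * (p (i + 1)).2 - (p (i + 1)).1 * (p i).2) ≤ 0 := by
  have hint : ∀ i ∈ Finset.range n, MeasureTheory.Integrable
      (fun t => (if (p i).1 ≤ (p (i + 1)).1 then (1 : ℝ) else -1) *
        (Set.uIoc (p i).1 (p (i + 1)).1).indicator (lineAt (p i) (p (i + 1))) t) := by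
    intro i _
    refine MeasureTheory.Integrable.const_mul ?_ _
    rw [MeasureTheory.integrable_indicator_iff measurableSet_uIoc]
    exact intervalIntegrable_iff.1 ((continuous_lineAt _ _).intervalIntegrable _ _)
  -- Corner abscissas form a null set, so the pointwise inequality at generic `t` suffices.
  have hnn : 0 ≤ ∫ t : ℝ, ∑ i ∈ Finset.range n,
      (if (p i).1 ≤ (p (i + 1)).1 then (1 : ℝ) else -1) *
        (Set.uIoc (p i).1 (p (i + 1)).1).indicator (lineAt (p i) (p (i + 1))) t := by
    refine MeasureTheory.integral_nonneg_of_ae ?_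
    have h0 : MeasureTheory.volume (Set.range fun k => (p k).1) = 0 :=
      (Set.countable_range _).measure_zero _
    filter_upwards [MeasureTheory.compl_mem_ae_iff.2 h0] with t ht
    exact S.sum_height_nonneg hκ fun k hk => ht ⟨k, hk⟩
  rw [MeasureTheory.integral_finsetSum _ hint] at hnn
  have hval : ∀ i ∈ Finset.range n, ∫ t : ℝ, (if (p i).1 ≤ (p (i + 1)).1 then (1 : ℝ) else -1) *
        (Set.uIoc (p i).1 (p (i + 1)).1).indicator (lineAt (p i) (p (i + 1))) t =
      (((p (i + 1)).1 * (p (i + 1)).2 - (p i).1 * (p i).2) -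
        ((p i).1 * (p (i + 1)).2 - (p (i + 1)).1 * (p i).2)) / 2 := by
    intro i _
    rw [MeasureTheory.integral_const_mul, MeasureTheory.integral_indicator measurableSet_uIoc,
      ← smul_eq_mul, ← intervalIntegral.intervalIntegral_eq_integral_uIoc,
      integral_lineAt (S.fst_ne_succ i)]
    ring
  -- By the trapezoid formula the integral is minus the signed area, up to the products of the
  -- coordinates of corners, which telescope around the polygon.
  rw [Finset.sum_congr rfl hval, ← Finset.sum_div, Finset.sum_sub_distrib,
    Finset.sum_range_sub (fun i => (p i).1 * (p i).2)] at hnn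
  have h0 : p n = p 0 := by simpa using S.periodic 0
  rw [h0, sub_self] at hnn
  linarith

/-- In a counterclockwise polygon, the lowest edges run to the right. -/
lemma edgeParity_eq_of_area_pos (S : SweepPolygon n p)
    (h : 0 < ∑ i ∈ Finset.range n, ((p i).1 * (p (i + 1)).2 - (p (i + 1)).1 * (p i).2)) (i : ℕ)
    (t : ℝ) (ht : GenericOn p i t) : edgeParity n p i t + ind ((p i).1 < (p (i + 1)).1) = 1 := by
  obtain ⟨κ, hκ⟩ := S.exists_edgeParity_eq
  rw [hκ i t ht]
  have hne : κ ≠ 0 := by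
    rintro rfl
    exact (S.area_nonpos hκ).not_gt h
  revert hne
  clear hκ
  revert κ
  decide

end SweepPolygon

/-! ### Order of the corners on the lower hull -/

/-- Some line through `p c` has all points of `p` with another abscissa strictly above it. -/
def IsLower (p : ℕ → Plane) (c : ℕ) : Prop :=
  ∃ m : ℝ, ∀ k, (p k).1 ≠ (p c).1 → (p c).2 + m * ((p k).1 - (p c).1) < (p k).2

/-- A segment with both end points above a line is above the line. -/
lemma lt_lineAt {a b : Plane} {t y m : ℝ} (ht : Between a.1 b.1 t) (ha : y + m * (a.1 - t) < a.2)
    (hb : y + m * (b.1 - t) < b.2) : y < lineAt a b t := by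
  have hab : b.1 - a.1 ≠ 0 := by
    rcases ht with h | h
    · exact (sub_pos.2 (h.1.trans h.2)).ne'
    · exact (sub_neg.2 (h.1.trans h.2)).ne
  have hid : lineAt a b t = ((b.1 - t) / (b.1 - a.1)) * a.2 + ((t - a.1) / (b.1 - a.1)) * b.2 := by
    unfold lineAt
    field_simp
    ring
  have hy : y = ((b.1 - t) / (b.1 - a.1)) * (y + m * (a.1 - t)) +
      ((t - a.1) / (b.1 - a.1)) * (y + m * (b.1 - t)) := by
    field_simp
    ring
  have h1 : 0 < (b.1 - t) / (b.1 - a.1) ∧ 0 < (t - a.1) / (b.1 - a.1) := by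
    rcases ht with h | h
    · exact ⟨div_pos (by linarith) (by linarith), div_pos (by linarith) (by linarith)⟩
    · exact ⟨div_pos_of_neg_of_neg (by linarith) (by linarith),
        div_pos_of_neg_of_neg (by linarith) (by linarith)⟩
  rw [hid, hy]
  exact add_lt_add (mul_lt_mul_of_pos_left ha h1.1) (mul_lt_mul_of_pos_left hb h1.2)

lemma IsLower.lt_lineAt {p : ℕ → Plane} {c : ℕ} (h : IsLower p c) {i j : ℕ}
    (hB : Between (p i).1 (p j).1 (p c).1) : (p c).2 < lineAt (p i) (p j) (p c).1 := by
  obtain ⟨m, hm⟩ := h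
  refine SepTangent.lt_lineAt (m := m) hB (hm i ?_) (hm j ?_)
  · rcases hB with hB | hB
    · exact hB.1.ne
    · exact hB.2.ne'
  · rcases hB with hB | hB
    · exact hB.2.ne'
    · exact hB.1.ne

lemma IsLower.below_eq {p : ℕ → Plane} {c : ℕ} (h : IsLower p c) (i j : ℕ) :
    below (p i) (p j) (p c) = 0 :=
  ind_false fun hc => lt_asymm hc.2 (h.lt_lineAt hc.1)

lemma IsLower.above_eq {p : ℕ → Plane} {c : ℕ} (h : IsLower p c) (i j : ℕ) :
    above (p i) (p j) (p c) = ind (Between (p i).1 (p j).1 (p c).1) :=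
  ind_congr (and_iff_left_of_imp fun hB => h.lt_lineAt hB)

lemma exists_modEq_Ico {n : ℕ} (hn : 0 < n) (a b : ℕ) :
    ∃ b', b' ≡ b [MOD n] ∧ a ≤ b' ∧ b' < a + n := by
  obtain ⟨m, rfl⟩ : ∃ m, n = m + 1 := ⟨n - 1, by omega⟩
  -- Since `m = n - 1`, the product `a * m` stands for `-a` modulo `n`, which avoids a subtraction.
  refine ⟨a + (b + a * m) % (m + 1), ?_, by omega, by have := Nat.mod_lt (b + a * m) hn; omega⟩
  have h1 : a + (b + a * m) % (m + 1) ≡ a + (b + a * m) [MOD m + 1] :=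
    (Nat.mod_modEq _ _).add_left a
  refine h1.trans ?_
  have h2 : a + (b + a * m) = b + a * (m + 1) := by ring
  rw [h2]
  unfold Nat.ModEq
  exact Nat.add_mul_mod_self_right b a (m + 1)

namespace SweepPolygon

variable {n : ℕ} {p : ℕ → Plane}

/-- Extend the path from `p 0` to `p c` by vertical rays going down from both ends. The rest of the
polygon crosses neither the path nor the rays, which lie below lower corners. Yet `p b` is enclosed,
whereas the corner after `p c` is not, because by `H` the lowest edges run to the right. -/
lemma not_lower_order_of_zero (S : SweepPolygon n p)
    (H : ∀ i t, GenericOn p i t → edgeParity n p i t + ind ((p i).1 < (p (i + 1)).1) = 1)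
    {b c : ℕ} (hc0 : 0 < c) (hcb : c < b) (hbn : b < n) (h0 : IsLower p 0) (hb : IsLower p b)
    (hc : IsLower p c) (hxb : (p 0).1 < (p b).1) (hxc : (p b).1 < (p c).1) : False := by
  -- The parity of crossings below `p j`; the last term stands for closing the curve far below
  -- between the two rays.
  set M : ℕ → ZMod 2 := fun j => ∑ k ∈ Finset.Ico 0 c, below (p k) (p (k + 1)) (p j) +
    ind (Between (p 0).1 (p c).1 (p j).1) with hM
  have hstep : ∀ j, c + 1 ≤ j → j + 1 < n → M (j + 1) = M j := by
    intro j hj hjn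
    have key := sum_below_add_below (p := p) (z := p j) (w := p (j + 1)) (S.fst_ne_succ j)
      (i := 0) (j := c) (by omega) (fun k _ => S.fst_ne_succ k)
      (fun k hk => S.fst_ne (by have := Finset.mem_Icc.1 hk; omega)
        (by have := Finset.mem_Icc.1 hk; omega))
      (fun k hk => S.fst_ne (by have := Finset.mem_Icc.1 hk; omega)
        (by have := Finset.mem_Icc.1 hk; omega))
      (fun k hk => S.disjoint k j (by have := Finset.mem_Ico.1 hk; omega)
        (by have := Finset.mem_Ico.1 hk; omega))
    -- At the lower corners `p 0` and `p c` only abscissas matter, and the interleaving terms are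
    -- the change of the last term of `M`.
    rw [h0.above_eq, hc.above_eq, ← ind_between_interleave
      (S.fst_ne (by omega) (by omega)) (S.fst_ne (by omega) (by omega))
      (S.fst_ne (by omega) (by omega)) (S.fst_ne (by omega) (by omega)),
      Finset.sum_add_distrib] at key
    have h2 : (2 : ZMod 2) = 0 := rfl
    simp only [hM]
    linear_combination key + (ind (Between (p 0).1 (p c).1 (p (j + 1)).1) -
      ∑ k ∈ Finset.Ico 0 c, below (p k) (p (k + 1)) (p j)) * h2
  have hMb : M b = 1 := by
    simp only [hM]
    rw [Finset.sum_eq_zero fun k _ => hb.below_eq k (k + 1), zero_add]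
    exact ind_true (Or.inl ⟨hxb, hxc⟩)
  have hMc : M (c + 1) = 1 := by
    rw [← hMb]
    have : ∀ j, c + 1 ≤ j → j < n → M j = M (c + 1) := by
      intro j hj
      induction j, hj using Nat.le_induction with
      | base => intro _; rfl
      | succ j hj ih => intro hjn; rw [hstep j hj hjn, ih (by omega)]
    exact (this b hcb hbn).symm
  obtain ⟨d, rfl⟩ : ∃ d, c = d + 1 := ⟨c - 1, by omega⟩
  -- The value at `p (c + 1)` follows from the edge leaving `p c`: the path up to `p d` is disjoint
  -- from it, and the adjacent edge from `p d` to `p c` enters through the turn at `p c`.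
  have key := sum_below_add_below (p := p) (z := p (d + 1)) (w := p (d + 2)) (S.fst_ne_succ _)
    (i := 0) (j := d) (by omega) (fun k _ => S.fst_ne_succ k)
    (fun k hk => S.fst_ne (by have := Finset.mem_Icc.1 hk; omega)
      (by have := Finset.mem_Icc.1 hk; omega))
    (fun k hk => S.fst_ne (by have := Finset.mem_Icc.1 hk; omega)
      (by have := Finset.mem_Icc.1 hk; omega))
    (fun k hk => S.disjoint k (d + 1) (by have := Finset.mem_Ico.1 hk; omega)
      (by have := Finset.mem_Ico.1 hk; omega))
  rw [Finset.sum_add_distrib, Finset.sum_eq_zero fun k _ => hc.below_eq k (k + 1), zero_add,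
    h0.above_eq] at key
  simp only [hM] at hMc
  rw [Finset.sum_Ico_succ_top (Nat.zero_le d), show d + 1 + 1 = d + 2 from rfl, key,
    below_comm (S.fst_ne_succ d), above_comm (S.fst_ne_succ (d + 1))] at hMc
  have hd0 : (p 0).1 ≠ (p (d + 2)).1 := S.fst_ne (by omega) (by omega)
  have hd1 : (p 0).1 ≠ (p (d + 1)).1 := (hxb.trans hxc).ne
  have hturn := above_add_below_eq_turnsBelow (S.fst_ne_succ (d + 1)).symm (S.fst_ne_succ d).symm
    (S.fst_ne (show d < d + 2 by omega) (by omega)).symm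
  obtain ⟨t, ht⟩ := S.exists_genericOn (d + 1)
  have hpar := S.edgeParity_add_cornerParity_start ht
  have hcor : cornerParity n p (d + 1) = 0 :=
    Finset.sum_eq_zero fun k _ => hc.below_eq k (k + 1)
  rw [hcor, add_zero] at hpar
  have hH := H (d + 1) t ht
  rw [hpar] at hH
  rw [ind_between hd1.symm hd0.symm, ind_between hd0 (S.fst_ne_succ (d + 1)),
    ind_false (hxb.trans hxc).not_gt] at hMc
  have hlt := ind_lt_add_ind_lt hd0
  have h2 : (2 : ZMod 2) = 0 := rfl
  have : (1 : ZMod 2) = 0 := by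
    simp only [Nat.add_assoc, Nat.reduceAdd] at hMc hH hturn
    linear_combination - hMc + hturn + hH + hlt + h2
  exact one_ne_zero this

/-- The lower corners of a counterclockwise polygon appear from the left to the right. -/
lemma exists_modEq_of_isLower (S : SweepPolygon n p)
    (hA : 0 < ∑ i ∈ Finset.range n, ((p i).1 * (p (i + 1)).2 - (p (i + 1)).1 * (p i).2))
    {a b c : ℕ} (hac : a ≤ c) (hca : c < a + n) (ha : IsLower p a) (hb : IsLower p b)
    (hc : IsLower p c) (hxb : (p a).1 < (p b).1) (hxc : (p b).1 < (p c).1) :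
    ∃ b', b' ≡ b [MOD n] ∧ a < b' ∧ b' < c := by
  have hn := S.three_le
  obtain ⟨b', hb', hab', hb'n⟩ := exists_modEq_Ico (by omega : 0 < n) a b
  have hpb : p b' = p b := S.eq_of_modEq hb'
  have hne : b' ≠ a := by rintro rfl; rw [hpb] at hxb; exact lt_irrefl _ hxb
  have hne' : b' ≠ c := by rintro rfl; rw [hpb] at hxc; exact lt_irrefl _ hxc
  refine ⟨b', hb', by omega, ?_⟩
  by_contra hcb
  have hne'' : a ≠ c := by rintro rfl; exact lt_asymm hxb hxc
  have hA' : 0 < ∑ i ∈ Finset.range n, ((p (a + i)).1 * (p (a + (i + 1))).2 -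
      (p (a + (i + 1))).1 * (p (a + i)).2) := by
    have := sum_Ico_of_periodic (n := n)
      (f := fun i => (p i).1 * (p (i + 1)).2 - (p (i + 1)).1 * (p i).2)
      (fun k => by rw [show k + n + 1 = k + 1 + n by omega, S.periodic, S.periodic]) a
    rw [Finset.sum_Ico_eq_sum_range, Nat.add_sub_cancel_left] at this
    exact this ▸ hA
  have hlow : ∀ k, a ≤ k → IsLower p k → IsLower (fun i => p (a + i)) (k - a) := by
    rintro k hk ⟨m, hm⟩
    refine ⟨m, fun j hj => ?_⟩
    simp only [Nat.add_sub_cancel' hk] at hj ⊢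
    exact hm _ hj
  have hb'' : IsLower p b' := by
    obtain ⟨m, hm⟩ := hb
    exact ⟨m, by rw [hpb]; exact hm⟩
  refine (S.shift a).not_lower_order_of_zero ((S.shift a).edgeParity_eq_of_area_pos hA')
    (c := c - a) (b := b' - a) (by omega) (by omega) (by omega)
    (by simpa using hlow a le_rfl ha) (hlow b' hab' hb'') (hlow c hac hc) ?_ ?_
  · simpa [Nat.add_sub_cancel' hab', hpb] using hxb
  · simpa [Nat.add_sub_cancel' hab', Nat.add_sub_cancel' hac, hpb] using hxc

end SweepPolygon

/-! ### A polygon seen by observers to its right -/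

/-- A counterclockwise polygon `p`, a set `Q` of observers to its right, and a line of slope `m`
through the corner `p r` that has all other corners of `p` strictly above it and no observer above
it. -/
structure Observed (n : ℕ) (p : ℕ → Plane) (Q : Set Plane) (r : ℕ) (m : ℝ) : Prop where
  sweep : SweepPolygon n p
  area_pos : 0 < ∑ i ∈ Finset.range n, ((p i).1 * (p (i + 1)).2 - (p (i + 1)).1 * (p i).2)
  fst_lt : ∀ q ∈ Q, ∀ i, (p i).1 < q.1
  slope_inj : ∀ q ∈ Q, ∀ i j, lineSlope (p i) q = lineSlope (p j) q → i ≡ j [MOD n]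
  lt : r < n
  lt_of_ne : ∀ k, ¬ k ≡ r [MOD n] → (p r).2 + m * ((p k).1 - (p r).1) < (p k).2
  le_of_mem : ∀ q ∈ Q, q.2 ≤ (p r).2 + m * (q.1 - (p r).1)

/-- The corner `p v` is the lowest one in the view of `q`. -/
def Lowest (p : ℕ → Plane) (q : Plane) (v : ℕ) : Prop :=
  ∀ k, lineSlope (p k) q ≤ lineSlope (p v) q

/-- For every observer on or above the line through `p s` and `q`, the lowest corner is met between
the indices `s` and `r + n`. -/
def LowestAhead (n : ℕ) (p : ℕ → Plane) (Q : Set Plane) (r s : ℕ) (q : Plane) : Prop :=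
  ∀ q' ∈ Q, lineSlope (p s) q ≤ lineSlope (p s) q' → ∀ v, Lowest p q' v →
    ∃ v', v' ≡ v [MOD n] ∧ s ≤ v' ∧ v' ≤ r + n

/-- The index `s` is before `r` in the first round, or before `r + n` with the lowest corners
ahead. -/
def Bounded (n : ℕ) (p : ℕ → Plane) (Q : Set Plane) (r s : ℕ) (q : Plane) : Prop :=
  s ≤ r ∨ (s ≤ r + n ∧ LowestAhead n p Q r s q)

/-- Raising the line through `p s` leaves fewer observers on or above it. This is what keeps the
bound when the other polygon moves. -/
lemma Bounded.of_slope_le {n : ℕ} {p : ℕ → Plane} {Q : Set Plane} {r s : ℕ} {q q' : Plane}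
    (h : Bounded n p Q r s q) (hq : lineSlope (p s) q ≤ lineSlope (p s) q') :
    Bounded n p Q r s q' :=
  h.imp_right fun h => ⟨h.1, fun q'' hq'' hs => h.2 q'' hq'' (hq.trans hs)⟩

namespace Observed

variable {n : ℕ} {p : ℕ → Plane} {Q : Set Plane} {r : ℕ} {m : ℝ}

lemma snd_eq (O : Observed n p Q r m) {q : Plane} (hq : q ∈ Q) (i : ℕ) :
    (p i).2 = q.2 - lineSlope (p i) q * (q.1 - (p i).1) := by
  have := SepTangent.snd_eq (O.fst_lt q hq i).ne
  linarith

lemma exists_lowest (O : Observed n p Q r m) (q : Plane) : ∃ v, Lowest p q v := by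
  have hn := O.sweep.three_le
  obtain ⟨v, _, hv⟩ := (Finset.range n).exists_max_image (fun k => lineSlope (p k) q)
    ⟨0, Finset.mem_range.2 (by omega)⟩
  refine ⟨v, fun k => ?_⟩
  rw [← O.sweep.eq_of_modEq (Nat.mod_modEq k n)]
  exact hv _ (Finset.mem_range.2 (Nat.mod_lt _ (by omega)))

lemma slope_lt (O : Observed n p Q r m) {q : Plane} (hq : q ∈ Q) {v k : ℕ} (hv : Lowest p q v)
    (hk : ¬ k ≡ v [MOD n]) :
    lineSlope (p k) q < lineSlope (p v) q :=
  lt_of_le_of_ne (hv k) fun h => hk (O.slope_inj q hq k v h)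

lemma isLower (O : Observed n p Q r m) {q : Plane} (hq : q ∈ Q) {v : ℕ} (hv : Lowest p q v) :
    IsLower p v := by
  refine ⟨lineSlope (p v) q, fun k hk => ?_⟩
  have h1 := O.slope_lt hq hv (k := k) fun h => hk (by rw [O.sweep.eq_of_modEq h])
  have h2 := O.snd_eq hq k
  have h3 := O.snd_eq hq v
  have h4 := O.fst_lt q hq k
  nlinarith

lemma isLower_r (O : Observed n p Q r m) : IsLower p r :=
  ⟨m, fun k hk => O.lt_of_ne k fun h => hk (by rw [O.sweep.eq_of_modEq h])⟩

/-- If `p v` were to the left of `p a`, the slope from `p v` to `p a` would be smaller than that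
from `p a` to `q`, since `p a` is lowest for `q`, and larger than that from `p a` to `q'`, since `p
v` is lowest for `q'`. This contradicts `hle`. -/
lemma fst_lt_of_lowest (O : Observed n p Q r m) {q q' : Plane} (hq : q ∈ Q) (hq' : q' ∈ Q)
    {a v : ℕ} (ha : Lowest p q a)
    (hv : Lowest p q' v) (hav : ¬ v ≡ a [MOD n]) (hle : lineSlope (p a) q ≤ lineSlope (p a) q') :
    (p a).1 < (p v).1 := by
  by_contra hlt
  have hne : (p v).1 ≠ (p a).1 := fun h => hav (O.sweep.fst_inj _ _ h)
  have hx : (p v).1 < (p a).1 := lt_of_le_of_ne (not_lt.1 hlt) hne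
  have h1 := O.slope_lt hq ha hav
  have h2 := O.slope_lt hq' hv fun h => hav h.symm
  have e1 := O.snd_eq hq a
  have e2 := O.snd_eq hq v
  have e3 := O.snd_eq hq' a
  have e4 := O.snd_eq hq' v
  have x1 := O.fst_lt q hq v
  have x2 := O.fst_lt q' hq' v
  have hA : (p a).2 - (p v).2 < lineSlope (p a) q * ((p a).1 - (p v).1) := by nlinarith
  have hB : lineSlope (p a) q' * ((p a).1 - (p v).1) < (p a).2 - (p v).2 := by nlinarith
  nlinarith

/-- Since `p v` is above the line of slope `m` through `p r` and `q` is not, the slope from `p v` to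
`q` is less than `m`. If `p v` were to the right of `p r`, then `p r` not being lower than `p v` in
the view of `q` would make that slope exceed `m`. -/
lemma fst_lt_r_of_lowest (O : Observed n p Q r m) {q : Plane} (hq : q ∈ Q) {v : ℕ}
    (hv : Lowest p q v)
    (hvr : ¬ v ≡ r [MOD n]) : (p v).1 < (p r).1 := by
  by_contra hlt
  have hne : (p v).1 ≠ (p r).1 := fun h => hvr (O.sweep.fst_inj _ _ h)
  have hx : (p r).1 < (p v).1 := lt_of_le_of_ne (not_lt.1 hlt) hne.symm
  have h1 := hv r
  have h2 := O.lt_of_ne v hvr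
  have h3 := O.le_of_mem q hq
  have e1 := O.snd_eq hq v
  have e2 := O.snd_eq hq r
  have x1 := O.fst_lt q hq v
  have x2 := O.fst_lt q hq r
  have hA : lineSlope (p v) q < m := by
    by_contra h
    nlinarith [mul_nonneg (sub_nonneg.2 (not_lt.1 h)) (sub_pos.2 x1).le]
  have hB : m < lineSlope (p v) q := by
    by_contra h
    nlinarith [mul_nonneg (sub_nonneg.2 (not_lt.1 h)) (sub_pos.2 hx).le,
      mul_nonneg (sub_nonneg.2 h1) (sub_pos.2 x2).le]
  exact lt_asymm hA hB

/-- The position of an observer that is below the line through the lowest corner `p a` in the view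
of `q`, and on or above the line through `p t` and `q`. -/
lemma observer_right (O : Observed n p Q r m) {q q' : Plane} (hq : q ∈ Q) (hq' : q' ∈ Q) {a t : ℕ}
    (ha : Lowest p q a)
    (hlt : lineSlope (p a) q' < lineSlope (p a) q) (hle : lineSlope (p t) q ≤ lineSlope (p t) q') :
    q.1 < q'.1 ∧ lineSlope (p t) q * (q'.1 - q.1) ≤ q'.2 - q.2 ∧
      q'.2 - q.2 < lineSlope (p a) q * (q'.1 - q.1) := by
  have e1 := O.snd_eq hq a
  have e2 := O.snd_eq hq t
  have e3 := O.snd_eq hq' a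
  have e4 := O.snd_eq hq' t
  have x1 := O.fst_lt q' hq' a
  have x2 := O.fst_lt q' hq' t
  have hA : lineSlope (p t) q * (q'.1 - q.1) ≤ q'.2 - q.2 := by
    nlinarith [mul_nonneg (sub_nonneg.2 hle) (sub_pos.2 x2).le]
  have hB : q'.2 - q.2 < lineSlope (p a) q * (q'.1 - q.1) := by
    nlinarith [mul_pos (sub_pos.2 hlt) (sub_pos.2 x1)]
  refine ⟨?_, hA, hB⟩
  -- As `p a` is lowest, its line to `q` is at least as steep as that of `p t`, so the wedge given
  -- by `hA` and `hB` opens only to the right.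
  by_contra h
  nlinarith [mul_nonneg (sub_nonneg.2 (ha t)) (sub_nonneg.2 (not_lt.1 h))]

/-- The observer `q'` lies in the wedge beyond `q` between the lines from `p t` and `p a`. The line
through `q` and `q'` continues to the left below `p v` and above `p a`, so from `q'` the corner `p
a` is lower than `p v`. -/
lemma not_lowest (O : Observed n p Q r m) {q q' : Plane} (hq : q ∈ Q) (hq' : q' ∈ Q) {a t v : ℕ}
    (ha : Lowest p q a)
    (hlt : lineSlope (p a) q' < lineSlope (p a) q) (hle : lineSlope (p t) q ≤ lineSlope (p t) q')
    (hvt : lineSlope (p v) q < lineSlope (p t) q) : ¬ Lowest p q' v := by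
  intro hv
  obtain ⟨h, hA, hB⟩ := O.observer_right hq hq' ha hlt hle
  have e1 := O.snd_eq hq a
  have e2 := O.snd_eq hq v
  have e3 := O.snd_eq hq' a
  have e4 := O.snd_eq hq' v
  have x1 := O.fst_lt q hq a
  have x2 := O.fst_lt q hq v
  have x3 := O.fst_lt q' hq' a
  have x4 := O.fst_lt q' hq' v
  have hd : 0 < q'.1 - q.1 := sub_pos.2 h
  set k := (q'.2 - q.2) / (q'.1 - q.1) with hk
  have hkd : q'.2 - q.2 = k * (q'.1 - q.1) := by rw [hk]; field_simp
  rw [hkd] at hA hB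
  have hA' : lineSlope (p t) q ≤ k := le_of_mul_le_mul_right hA hd
  have hB' : k < lineSlope (p a) q := lt_of_mul_lt_mul_right hB hd.le
  have h1 : k < lineSlope (p a) q' := by
    by_contra hc
    nlinarith [mul_nonneg (sub_nonneg.2 (not_lt.1 hc)) (sub_pos.2 x3).le,
      mul_pos (sub_pos.2 hB') (sub_pos.2 x1)]
  have h2 : lineSlope (p v) q' < k := by
    by_contra hc
    nlinarith [mul_nonneg (sub_nonneg.2 (not_lt.1 hc)) (sub_pos.2 x4).le,
      mul_pos (sub_pos.2 (hvt.trans_le hA')) (sub_pos.2 x2)]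
  exact (h2.trans h1).not_ge (hv a)

/-- The index bound is kept when `s` moves on to the next index that is lower in the view of `q`. -/
lemma bounded_advance (O : Observed n p Q r m) {q : Plane} (hq : q ∈ Q) {s t : ℕ}
    (hs : Bounded n p Q r s q)
    (hchain : ∀ j, s ≤ j → j < t → lineSlope (p j) q ≤ lineSlope (p s) q)
    (ht : lineSlope (p s) q < lineSlope (p t) q) : Bounded n p Q r t q := by
  have hn := O.sweep.three_le
  have hr := O.lt
  rcases Nat.lt_or_ge r t with hrt | hrt
  swap
  · exact Or.inl hrt
  obtain ⟨a₀, ha₀⟩ := O.exists_lowest q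
  have hrep : ∀ {x y : ℕ}, x ≡ y [MOD n] → p x = p y := O.sweep.eq_of_modEq
  -- the lowest corner is met after `t`
  obtain ⟨a, haa, hta, har⟩ : ∃ a, a ≡ a₀ [MOD n] ∧ t ≤ a ∧ a ≤ r + n := by
    obtain ⟨a, haa, hsa, har⟩ : ∃ a, a ≡ a₀ [MOD n] ∧ s ≤ a ∧ a ≤ r + n := by
      rcases hs with hs | hs
      · obtain ⟨a, h1, h2, h3⟩ := exists_modEq_Ico (by omega : 0 < n) s a₀
        exact ⟨a, h1, h2, by omega⟩
      · exact hs.2 q hq le_rfl a₀ ha₀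
    -- By `hchain`, the corners from `s` to `t - 1` are not lower than `p s`, hence higher than `p
    -- t`, so none of them is the lowest.
    refine ⟨a, haa, ?_, har⟩
    by_contra hat
    have h1 := hchain a hsa (by omega)
    rw [hrep haa] at h1
    exact (ht.trans_le (ha₀ t)).not_ge h1
  have ha : Lowest p q a := by
    intro k
    rw [hrep haa]
    exact ha₀ k
  refine Or.inr ⟨by omega, fun q' hq' hle v hv => ?_⟩
  -- Either `q'` is on or above the line through `p a` and `q`, and its lowest corner is found on
  -- the lower hull, or `q'` is in the wedge of `observer_right`.
  rcases le_or_gt (lineSlope (p a) q) (lineSlope (p a) q') with hup | hup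
  · by_cases hva : v ≡ a [MOD n]
    · exact ⟨a, hva.symm, hta, har⟩
    by_cases hvr : v ≡ r [MOD n]
    · refine ⟨r + n, ?_, by omega, le_rfl⟩
      exact (Nat.add_mod_right r n).trans hvr.symm
    have hpr : p (r + n) = p r := O.sweep.periodic r
    have hlowr : IsLower p (r + n) := by
      obtain ⟨m', hm'⟩ := O.isLower_r
      exact ⟨m', by rw [hpr]; exact hm'⟩
    -- The corners `p a`, `p v`, `p r` are lower corners from left to right, and `a ≤ r + n < a + n`
    -- because `r < t ≤ a`.
    obtain ⟨v', h1, h2, h3⟩ := O.sweep.exists_modEq_of_isLower O.area_pos har (by omega)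
      (O.isLower hq ha) (O.isLower hq' hv) hlowr (O.fst_lt_of_lowest hq hq' ha hv hva hup)
      (by rw [hpr]; exact O.fst_lt_r_of_lowest hq' hv hvr)
    exact ⟨v', h1, by omega, h3.le⟩
  · have hnot : ∀ v', v' ≡ v [MOD n] → s ≤ v' → t ≤ v' := by
      intro v' h1 h2
      by_contra h3
      have h4 := hchain v' h2 (by omega)
      rw [hrep h1] at h4
      exact O.not_lowest hq hq' ha hup hle (h4.trans_lt ht) hv
    obtain ⟨v', h1, h2, h3⟩ : ∃ v', v' ≡ v [MOD n] ∧ s ≤ v' ∧ v' ≤ r + n := by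
      rcases hs with hs | hs
      · obtain ⟨v', h1, h2, h3⟩ := exists_modEq_Ico (by omega : 0 < n) s v
        exact ⟨v', h1, h2, by omega⟩
      -- Being to the right of `q` and on or above the line from `p t`, the observer `q'` is also
      -- above the flatter line from `p s`, so the old bound applies to it.
      · refine hs.2 q' hq' ?_ v hv
        obtain ⟨h, hA, hB⟩ := O.observer_right hq hq' ha hup hle
        by_contra hc
        have e1 := O.snd_eq hq s
        have e2 := O.snd_eq hq' s
        have x2 := O.fst_lt q' hq' s
        nlinarith [mul_pos (sub_pos.2 (not_le.1 hc)) (sub_pos.2 x2),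
          mul_pos (sub_pos.2 ht) (sub_pos.2 h)]
    exact ⟨v', h1, hnot v' h1 h2, h3⟩

end Observed

/-! ### Corners and edges with indices modulo the number of corners -/

section Corner

variable {n : ℕ} [NeZero n]

lemma ofNat_eq_iff {i j : ℕ} : Fin.ofNat n i = Fin.ofNat n j ↔ i ≡ j [MOD n] := by
  rw [Fin.ext_iff]
  rfl

lemma corner_congr (P : Polygon Plane n) {i j : ℕ} (h : i ≡ j [MOD n]) :
    corner P i = corner P j := by
  unfold corner
  rw [ofNat_eq_iff.2 h]

lemma corner_add_self (P : Polygon Plane n) (i : ℕ) : corner P (i + n) = corner P i :=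
  corner_congr P (Nat.add_mod_right i n)

lemma corner_val (P : Polygon Plane n) (i : Fin n) : corner P i = P i := by
  unfold corner
  congr 1
  exact Fin.ext (Nat.mod_eq_of_lt i.isLt)

lemma finRotate_ofNat (i : ℕ) : finRotate n (Fin.ofNat n i) = Fin.ofNat n (i + 1) := by
  rw [finRotate_apply]
  ext
  rw [Fin.val_add]
  simp [Fin.ofNat, Nat.add_mod]

lemma edgeSet_ofNat (P : Polygon Plane n) (i : ℕ) :
    P.edgeSet ℝ (Fin.ofNat n i) = segment ℝ (corner P i) (corner P (i + 1)) := by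
  unfold Polygon.edgeSet corner
  rw [finRotate_ofNat, affineSegment_eq_segment]

lemma corner_finRotate (P : Polygon Plane n) (i : Fin n) :
    P (finRotate n i) = corner P (i + 1) := by
  have h : Fin.ofNat n (i : ℕ) = i := Fin.ext (Nat.mod_eq_of_lt i.isLt)
  rw [← h, finRotate_ofNat, h, corner]

lemma sum_fin_eq_sum_range {M : Type*} [AddCommMonoid M] (P : Polygon Plane n)
    (f : Plane → Plane → M) :
    ∑ i : Fin n, f (P i) (P (finRotate n i)) =
      ∑ i ∈ Finset.range n, f (corner P i) (corner P (i + 1)) := by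
  rw [Finset.sum_range]
  refine Finset.sum_congr rfl fun i _ => ?_
  rw [corner_val, corner_finRotate]

end Corner

/-! ### Orientation -/

/-- Twice the signed area of the triangle `a b c`. -/
def cross (a b c : Plane) : ℝ := (b.1 - a.1) * (c.2 - a.2) - (b.2 - a.2) * (c.1 - a.1)

lemma orient_eq (a b c : Plane) : orient a b c = SignType.sign (cross a b c) := by
  unfold orient cross dot perp
  congr 1
  simp only [Prod.fst_sub, Prod.snd_sub]
  ring

lemma orient_eq_one_iff {a b c : Plane} : orient a b c = 1 ↔ 0 < cross a b c := by
  rw [orient_eq, sign_eq_one_iff]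

lemma mem_LHP_iff {a b c : Plane} : c ∈ LHP a b ↔ 0 ≤ cross a b c := by
  unfold LHP
  rw [Set.mem_ofPred_eq, orient_eq, sign_nonneg_iff]

lemma collinear_of_cross_eq_zero {a b c : Plane} (hab : a ≠ b) (h : cross a b c = 0) :
    Collinear ℝ ({a, b, c} : Set Plane) := by
  rw [collinear_iff_of_mem (p₀ := a) (by simp)]
  refine ⟨b - a, ?_⟩
  have hne : (b.1 - a.1) ^ 2 + (b.2 - a.2) ^ 2 ≠ 0 := by
    intro h0
    apply hab
    ext <;> nlinarith [sq_nonneg (b.1 - a.1), sq_nonneg (b.2 - a.2)]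
  unfold cross at h
  intro p hp
  simp only [Set.mem_insert_iff, Set.mem_singleton_iff] at hp
  rcases hp with rfl | rfl | rfl
  · exact ⟨0, by simp⟩
  · exact ⟨1, by simp⟩
  · refine ⟨((p.1 - a.1) * (b.1 - a.1) + (p.2 - a.2) * (b.2 - a.2)) /
      ((b.1 - a.1) ^ 2 + (b.2 - a.2) ^ 2), ?_⟩
    ext
    · simp only [vadd_eq_add, Prod.fst_add, Prod.smul_fst, Prod.fst_sub, smul_eq_mul]
      field_simp
      linear_combination (b.2 - a.2) * (-h)
    · simp only [vadd_eq_add, Prod.snd_add, Prod.smul_snd, Prod.snd_sub, smul_eq_mul]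
      field_simp
      linear_combination (b.1 - a.1) * h

/-! ### Rotated coordinates -/

/-- The rotation, up to scaling, for which the first coordinate is the product with `φ`. -/
def rot (φ : Plane) : Plane →ₗ[ℝ] Plane where
  toFun x := (φ.1 * x.1 + φ.2 * x.2, φ.1 * x.2 - φ.2 * x.1)
  map_add' x y := by ext <;> simp <;> ring
  map_smul' c x := by ext <;> simp <;> ring

lemma rot_apply (φ x : Plane) : rot φ x = (φ.1 * x.1 + φ.2 * x.2, φ.1 * x.2 - φ.2 * x.1) := rfl

lemma normSq_pos {φ : Plane} (h : φ ≠ 0) : 0 < φ.1 ^ 2 + φ.2 ^ 2 := by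
  rcases eq_or_ne φ.1 0 with h1 | h1
  · have : φ.2 ≠ 0 := fun h2 => h (Prod.ext h1 h2)
    positivity
  · positivity

lemma cross_rot (φ a b c : Plane) :
    cross (rot φ a) (rot φ b) (rot φ c) = (φ.1 ^ 2 + φ.2 ^ 2) * cross a b c := by
  simp only [cross, rot_apply]
  ring

lemma rot_injective {φ : Plane} (h : φ ≠ 0) : Function.Injective (rot φ) := by
  intro a b hab
  have hpos := normSq_pos h
  have h1 := congrArg Prod.fst hab
  have h2 := congrArg Prod.snd hab
  simp only [rot_apply] at h1 h2
  ext
  · apply mul_left_cancel₀ hpos.ne'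
    linear_combination φ.1 * h1 - φ.2 * h2
  · apply mul_left_cancel₀ hpos.ne'
    linear_combination φ.2 * h1 + φ.1 * h2

lemma segment_rot (φ a b : Plane) : segment ℝ (rot φ a) (rot φ b) = rot φ '' segment ℝ a b :=
  (image_segment ℝ (rot φ).toAffineMap a b).symm

lemma rot_neg (φ x : Plane) : rot (-φ) x = - rot φ x := by
  ext <;> simp [rot_apply] <;> ring

lemma lineSlope_neg (a b : Plane) : lineSlope (-a) (-b) = lineSlope a b := by
  unfold lineSlope
  rw [Prod.fst_neg, Prod.fst_neg, Prod.snd_neg, Prod.snd_neg, ← neg_div_neg_eq]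
  congr 1 <;> ring

/-- Comparison of slopes by an orientation. -/
lemma lineSlope_lt_iff {a b q : Plane} (ha : a.1 < q.1) (hb : b.1 < q.1) :
    lineSlope a q < lineSlope b q ↔ 0 < cross q a b := by
  unfold lineSlope cross
  rw [div_lt_div_iff₀ (sub_pos.2 ha) (sub_pos.2 hb)]
  constructor <;> intro h <;> nlinarith

lemma lineSlope_eq_iff {a b q : Plane} (ha : a.1 ≠ q.1) (hb : b.1 ≠ q.1) :
    lineSlope a q = lineSlope b q ↔ cross q a b = 0 := by
  unfold lineSlope cross
  rw [div_eq_div_iff (sub_ne_zero.2 ha.symm) (sub_ne_zero.2 hb.symm)]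
  constructor <;> intro h <;> linarith

lemma not_modEq_of_lt {n i j : ℕ} (h : i < j) (h' : j < i + n) : ¬ i ≡ j [MOD n] := by
  intro he
  have := Nat.le_of_dvd (by omega) ((Nat.modEq_iff_dvd' h.le).1 he)
  omega

section Sweep

variable {n : ℕ} [NeZero n] {P : Polygon Plane n} {φ : Plane}

lemma IsSimple.corner_ne (hP : IsSimple P) {i j : ℕ} (h : ¬ i ≡ j [MOD n]) :
    corner P i ≠ corner P j := fun he => h (ofNat_eq_iff.1 (hP.injective he))

/-- A simple polygon in coordinates where its corners have distinct abscissas. -/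
lemma IsSimple.sweepPolygon (hP : IsSimple P)
    (hcol : ∀ i j k, ¬ i ≡ j [MOD n] → ¬ j ≡ k [MOD n] → ¬ i ≡ k [MOD n] →
      cross (corner P i) (corner P j) (corner P k) ≠ 0)
    (hφ : φ ≠ 0) (hinj : ∀ i j, dot φ (corner P i) = dot φ (corner P j) → i ≡ j [MOD n]) :
    SweepPolygon n (fun i => rot φ (corner P i)) := by
  have hn := hP.three_le
  refine ⟨hn, fun i => ?_, hinj, fun i j h h' => ?_, fun i => ?_, fun i => ?_⟩
  · rw [corner_add_self]
  · rw [segment_rot, segment_rot, Set.disjoint_image_iff (rot_injective hφ), ← edgeSet_ofNat,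
      ← edgeSet_ofNat]
    refine hP.disjoint _ _ ?_ ?_ ?_
    · rw [Ne, ofNat_eq_iff]
      exact not_modEq_of_lt (by omega) (by omega)
    · rw [finRotate_ofNat, Ne, ofNat_eq_iff]
      exact fun he => not_modEq_of_lt h (by omega) he.symm
    · rw [finRotate_ofNat, Ne, ofNat_eq_iff]
      exact not_modEq_of_lt (by omega) h'
  · have h1 := hP.consecutive (Fin.ofNat n i)
    rw [finRotate_ofNat, edgeSet_ofNat, edgeSet_ofNat] at h1
    rw [segment_rot, segment_rot, ← Set.image_inter (rot_injective hφ), h1, Set.image_singleton]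
    rfl
  · have hd : ∀ i, dot φ (corner P i) ≠ dot φ (corner P (i + 1)) := fun i h =>
      not_modEq_of_lt (n := n) (Nat.lt_succ_self i) (by omega) (hinj _ _ h)
    rw [lineSlope_symm _ (rot φ (corner P i)), lineSlope_symm _ (rot φ (corner P (i + 2))), Ne,
      lineSlope_eq_iff (hd i) (hd (i + 1)).symm, cross_rot]
    refine mul_ne_zero (normSq_pos hφ).ne' (hcol _ _ _ ?_ ?_ ?_)
    · exact fun h => not_modEq_of_lt (Nat.lt_succ_self i) (by omega) h.symm
    · exact not_modEq_of_lt (by omega) (by omega)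
    · exact not_modEq_of_lt (by omega) (by omega)

lemma IsCounterclockwise.sum_pos (hP : IsCounterclockwise P) (hφ : φ ≠ 0) :
    0 < ∑ i ∈ Finset.range n, ((rot φ (corner P i)).1 * (rot φ (corner P (i + 1))).2 -
      (rot φ (corner P (i + 1))).1 * (rot φ (corner P i)).2) := by
  unfold IsCounterclockwise signedArea at hP
  rw [sum_fin_eq_sum_range P (fun a b => a.1 * b.2 - b.1 * a.2)] at hP
  have h1 : ∀ i ∈ Finset.range n, (rot φ (corner P i)).1 * (rot φ (corner P (i + 1))).2 -
      (rot φ (corner P (i + 1))).1 * (rot φ (corner P i)).2 = (φ.1 ^ 2 + φ.2 ^ 2) *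
        ((corner P i).1 * (corner P (i + 1)).2 - (corner P (i + 1)).1 * (corner P i).2) := by
    intro i _
    simp only [rot_apply]
    ring
  rw [Finset.sum_congr rfl h1, ← Finset.mul_sum]
  exact mul_pos (normSq_pos hφ) (by linarith)

/-- A polygon and the observers to its right, where `m` is the largest slope. -/
lemma observed_of_slope_max (hP : IsSimple P) (hccw : IsCounterclockwise P)
    (hcol : ∀ i j k, ¬ i ≡ j [MOD n] → ¬ j ≡ k [MOD n] → ¬ i ≡ k [MOD n] →
      cross (corner P i) (corner P j) (corner P k) ≠ 0)
    (hφ : φ ≠ 0) (hinj : ∀ i j, dot φ (corner P i) = dot φ (corner P j) → i ≡ j [MOD n])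
    {Q : Set Plane} (hQ : ∀ q ∈ Q, ∀ i, dot φ (corner P i) < dot φ q)
    (hcolQ : ∀ q ∈ Q, ∀ i j, ¬ i ≡ j [MOD n] → cross q (corner P i) (corner P j) ≠ 0)
    {m : ℝ} (hm : ∀ q ∈ Q, ∀ i, lineSlope (rot φ (corner P i)) (rot φ q) ≤ m) {r : ℕ} (hr : r < n)
    {q₀ : Plane} (hq₀ : q₀ ∈ Q) (hrm : lineSlope (rot φ (corner P r)) (rot φ q₀) = m) :
    Observed n (fun i => rot φ (corner P i)) (rot φ '' Q) r m := by
  have hslope : ∀ q ∈ Q, ∀ i j, lineSlope (rot φ (corner P i)) (rot φ q) =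
      lineSlope (rot φ (corner P j)) (rot φ q) → i ≡ j [MOD n] := by
    intro q hq i j h
    rw [lineSlope_eq_iff (hQ q hq i).ne (hQ q hq j).ne, cross_rot] at h
    by_contra hij
    exact mul_ne_zero (normSq_pos hφ).ne' (hcolQ q hq i j hij) h
  refine ⟨hP.sweepPolygon hcol hφ hinj, hccw.sum_pos hφ, ?_, ?_, hr, fun k hk => ?_, ?_⟩
  · rintro _ ⟨q, hq, rfl⟩ i
    exact hQ q hq i
  · rintro _ ⟨q, hq, rfl⟩ i j h
    exact hslope q hq i j h
  -- The line of slope `m` through `p r` contains `q₀`. From there `p r` has the largest slope,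
  -- strictly so by general position, hence all other corners are above the line.
  · have h1 : lineSlope (rot φ (corner P k)) (rot φ q₀) < m :=
      lt_of_le_of_ne (hm q₀ hq₀ k) fun h => hk (hslope q₀ hq₀ k r (h.trans hrm.symm))
    have h2 := snd_eq (a := rot φ (corner P k)) (b := rot φ q₀) (hQ q₀ hq₀ k).ne
    have h3 := snd_eq (a := rot φ (corner P r)) (b := rot φ q₀) (hQ q₀ hq₀ r).ne
    have h4 : (rot φ (corner P k)).1 < (rot φ q₀).1 := hQ q₀ hq₀ k
    rw [hrm] at h3
    nlinarith
  · rintro _ ⟨q, hq, rfl⟩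
    have h1 := hm q hq r
    have h3 := snd_eq (a := rot φ (corner P r)) (b := rot φ q) (hQ q hq r).ne
    have h4 : (rot φ (corner P r)).1 < (rot φ q).1 := hQ q hq r
    nlinarith

end Sweep

/-! ### Convex hulls -/

section Hull

variable {n : ℕ} [NeZero n] (P : Polygon Plane n)

lemma range_corner : Set.range (corner P) = Set.range P.vertices := by
  ext x
  constructor
  · rintro ⟨i, rfl⟩
    exact ⟨_, rfl⟩
  · rintro ⟨i, rfl⟩
    exact ⟨i, corner_val P i⟩

lemma boundary_eq : P.boundary ℝ = ⋃ i, segment ℝ (corner P i) (corner P (i + 1)) := by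
  ext x
  simp only [Polygon.boundary, Set.mem_iUnion]
  constructor
  · rintro ⟨i, hi⟩
    refine ⟨i, ?_⟩
    rw [← edgeSet_ofNat]
    have h : Fin.ofNat n (i : ℕ) = i := Fin.ext (Nat.mod_eq_of_lt i.isLt)
    rwa [h]
  · rintro ⟨i, hi⟩
    exact ⟨Fin.ofNat n i, by rwa [edgeSet_ofNat]⟩

lemma corner_mem_boundary (i : ℕ) : corner P i ∈ P.boundary ℝ := by
  rw [boundary_eq]
  exact Set.mem_iUnion.2 ⟨i, left_mem_segment ℝ _ _⟩

lemma boundary_subset_of_convex {s : Set Plane} (hs : Convex ℝ s) (h : ∀ i, corner P i ∈ s) :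
    P.boundary ℝ ⊆ s := by
  rw [boundary_eq]
  exact Set.iUnion_subset fun i => hs.segment_subset (h i) (h (i + 1))

lemma convexHull_boundary : convexHull ℝ (P.boundary ℝ) = convexHull ℝ (Set.range P.vertices) := by
  apply Set.Subset.antisymm
  · refine convexHull_min (boundary_subset_of_convex P (convex_convexHull ℝ _) fun i => ?_)
      (convex_convexHull ℝ _)
    exact subset_convexHull ℝ _ ⟨_, rfl⟩
  · refine convexHull_mono ?_
    rw [← range_corner]
    rintro _ ⟨i, rfl⟩
    exact corner_mem_boundary P i

end Hull

/-! ### Separation of disjoint convex hulls -/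

section Pair

variable {n : Fin 2 → ℕ} [∀ k, NeZero (n k)] {P : (k : Fin 2) → Polygon Plane (n k)}

lemma GeneralPosition.corner_ne (h : GeneralPosition P) (k : Fin 2) (i j : ℕ) :
    corner (P (1 - k)) i ≠ corner (P k) j := by
  fin_cases k
  · exact (h.1 _ _).symm
  · exact h.1 _ _

lemma GeneralPosition.cross_ne_zero (h : GeneralPosition P) {k k' k'' : Fin 2} {i j l : ℕ}
    (h1 : corner (P k) i ≠ corner (P k') j) (h2 : corner (P k') j ≠ corner (P k'') l)
    (h3 : corner (P k) i ≠ corner (P k'') l) :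
    cross (corner (P k) i) (corner (P k') j) (corner (P k'') l) ≠ 0 := fun h0 =>
  h.2 _ (Set.mem_iUnion.2 ⟨k, _, rfl⟩) _ (Set.mem_iUnion.2 ⟨k', _, rfl⟩) _
    (Set.mem_iUnion.2 ⟨k'', _, rfl⟩) h1 h2 h3 (collinear_of_cross_eq_zero h1 h0)

lemma dot_add_smul (φ ψ w : Plane) (ε : ℝ) : dot (φ + ε • ψ) w = dot φ w + ε * dot ψ w := by
  simp [dot]
  ring

lemma dot_sub (φ a b : Plane) : dot φ (a - b) = dot φ a - dot φ b := by
  simp [dot]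
  ring

open Filter Topology in
-- A nonzero `w` orthogonal to `φ` is not orthogonal to `perp φ`, so every positive `ε` works;
-- otherwise small `ε` works by continuity.
lemma eventually_dot_ne_zero {φ w : Plane} (hφ : φ ≠ 0) (hw : w ≠ 0) :
    ∀ᶠ ε in 𝓝[>] (0 : ℝ), dot (φ + ε • perp φ) w ≠ 0 := by
  have hcont : Tendsto (fun ε : ℝ => dot φ w + ε * dot (perp φ) w) (𝓝[>] 0) (𝓝 (dot φ w)) := by
    have : Tendsto (fun ε : ℝ => dot φ w + ε * dot (perp φ) w) (𝓝 0)
        (𝓝 (dot φ w + 0 * dot (perp φ) w)) := Continuous.tendsto (by fun_prop) 0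
    rw [zero_mul, add_zero] at this
    exact this.mono_left nhdsWithin_le_nhds
  by_cases h0 : dot φ w = 0
  · filter_upwards [self_mem_nhdsWithin] with ε hε
    rw [dot_add_smul, h0, zero_add]
    refine mul_ne_zero (ne_of_gt hε) fun h1 => hw (rot_injective hφ ?_)
    rw [map_zero]
    refine Prod.ext h0 (Eq.trans ?_ h1)
    simp only [rot_apply, dot, perp]
    ring
  · filter_upwards [hcont.eventually_ne h0] with ε hε
    rwa [dot_add_smul]

open Filter Topology in
lemma eventually_dot_pos {φ w : Plane} (hw : 0 < dot φ w) :
    ∀ᶠ ε in 𝓝[>] (0 : ℝ), 0 < dot (φ + ε • perp φ) w := by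
  have hcont : Tendsto (fun ε : ℝ => dot φ w + ε * dot (perp φ) w) (𝓝[>] 0) (𝓝 (dot φ w)) := by
    have : Tendsto (fun ε : ℝ => dot φ w + ε * dot (perp φ) w) (𝓝 0)
        (𝓝 (dot φ w + 0 * dot (perp φ) w)) := Continuous.tendsto (by fun_prop) 0
    rw [zero_mul, add_zero] at this
    exact this.mono_left nhdsWithin_le_nhds
  filter_upwards [hcont.eventually_const_lt hw] with ε hε
  rwa [dot_add_smul]

/-- Polygons with disjoint convex hulls are strictly separated by a line in generic direction. -/
lemma exists_generic_separation (hP : ∀ k, IsSimple (P k))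
    (hdisj : Disjoint (convexHull ℝ ((P 0).boundary ℝ)) (convexHull ℝ ((P 1).boundary ℝ))) :
    ∃ φ : Plane, φ ≠ 0 ∧ (∀ i j, dot φ (corner (P 0) i) < dot φ (corner (P 1) j)) ∧
      ∀ k i j, dot φ (corner (P k) i) = dot φ (corner (P k) j) → i ≡ j [MOD n k] := by
  rw [convexHull_boundary, convexHull_boundary] at hdisj
  obtain ⟨f, u, v, hu, huv, hv⟩ := geometric_hahn_banach_compact_closed (convex_convexHull ℝ _)
    ((Set.finite_range (P 0).vertices).isCompact_convexHull ℝ) (convex_convexHull ℝ _)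
    ((Set.finite_range (P 1).vertices).isClosed_convexHull ℝ) hdisj
  set φ : Plane := (f (1, 0), f (0, 1)) with hφ
  have hf : ∀ x, f x = dot φ x := by
    intro x
    have hx : x = x.1 • ((1, 0) : Plane) + x.2 • ((0, 1) : Plane) := by ext <;> simp
    conv_lhs => rw [hx]
    rw [map_add, map_smul, map_smul]
    simp only [dot, hφ, smul_eq_mul]
    ring
  have hsep : ∀ (i : Fin (n 0)) (j : Fin (n 1)), dot φ (P 0 i) < dot φ (P 1 j) := by
    intro i j
    have h1 := hu _ (subset_convexHull ℝ _ ⟨i, rfl⟩)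
    have h2 := hv _ (subset_convexHull ℝ _ ⟨j, rfl⟩)
    rw [hf] at h1 h2
    linarith
  have hφ0 : φ ≠ 0 := by
    intro h0
    have := hsep 0 0
    rw [h0] at this
    simp [dot] at this
  -- The direction from Hahn-Banach is tilted slightly: each of finitely many conditions holds for
  -- all small positive `ε`.
  have h1 : ∀ᶠ ε in nhdsWithin (0 : ℝ) (Set.Ioi 0), ∀ (i : Fin (n 0)) (j : Fin (n 1)),
      0 < dot (φ + ε • perp φ) (P 1 j - P 0 i) := by
    rw [Filter.eventually_all]
    intro i
    rw [Filter.eventually_all]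
    intro j
    refine eventually_dot_pos ?_
    rw [dot_sub]
    exact sub_pos.2 (hsep i j)
  have h2 : ∀ᶠ ε in nhdsWithin (0 : ℝ) (Set.Ioi 0), ∀ (k : Fin 2) (i j : Fin (n k)), i ≠ j →
      dot (φ + ε • perp φ) (P k i - P k j) ≠ 0 := by
    rw [Filter.eventually_all]
    intro k
    rw [Filter.eventually_all]
    intro i
    rw [Filter.eventually_all]
    intro j
    rw [Filter.eventually_imp_distrib_left]
    exact fun hij => eventually_dot_ne_zero hφ0
      (sub_ne_zero.2 fun h => hij ((hP k).injective h))
  obtain ⟨ε, h3, h4⟩ := (h1.and h2).exists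
  refine ⟨φ + ε • perp φ, ?_, fun i j => ?_, fun k i j h => ?_⟩
  · intro h0
    have := h3 0 0
    rw [h0] at this
    simp [dot] at this
  · have := h3 (Fin.ofNat _ i) (Fin.ofNat _ j)
    rw [dot_sub] at this
    exact sub_pos.1 this
  · by_contra hij
    refine h4 k (Fin.ofNat _ i) (Fin.ofNat _ j) (fun he => hij (ofNat_eq_iff.1 he)) ?_
    rw [dot_sub]
    exact sub_eq_zero.2 h

lemma one_sub_one_sub (k : Fin 2) : 1 - (1 - k) = k := by
  fin_cases k <;> rfl

/-- For polygons with disjoint convex hulls, there is an invariant of the moves of the algorithm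
that bounds the indices by twice the numbers of corners. -/
theorem exists_bounding_invariant (hP : ∀ k, IsSimple (P k)) (hccw : ∀ k, IsCounterclockwise (P k))
    (hgp : GeneralPosition P)
    (hdisj : Disjoint (convexHull ℝ ((P 0).boundary ℝ)) (convexHull ℝ ((P 1).boundary ℝ))) :
    ∃ B : Fin 2 → ℕ → ℕ → Prop, (∀ k j, B k 0 j) ∧
      (∀ k s t j, B k s j →
        (∀ i, s ≤ i → i < t →
          orient (corner (P (1 - k)) j) (corner (P k) s) (corner (P k) i) ≠ 1) →
        orient (corner (P (1 - k)) j) (corner (P k) s) (corner (P k) t) = 1 → B k t j) ∧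
      (∀ k s t j, B (1 - k) j s →
        orient (corner (P (1 - k)) j) (corner (P k) s) (corner (P k) t) = 1 → B (1 - k) j t) ∧
      ∀ k s j, B k s j → s < 2 * n k := by
  obtain ⟨φ, hφ0, hsep, hinj⟩ := exists_generic_separation hP hdisj
  set c : Fin 2 → ℕ → Plane := fun k i => corner (P k) i with hc
  -- A half turn for `k = 1` puts each polygon in turn to the left of the other. It preserves
  -- slopes, so both views share `σ` and its maximum `m`.
  set Φ : Fin 2 → Plane := ![φ, -φ] with hΦ
  have hΦ0 : ∀ k, Φ k ≠ 0 := by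
    intro k
    fin_cases k
    · exact hφ0
    · exact neg_ne_zero.2 hφ0
  have hneg : ∀ k, Φ (1 - k) = - Φ k := by
    intro k
    fin_cases k <;> simp [hΦ]
  have hdotneg : ∀ x, dot (-φ) x = - dot φ x := by
    intro x
    simp [dot]
    ring
  have hlt : ∀ k i j, dot (Φ k) (c k i) < dot (Φ k) (c (1 - k) j) := by
    intro k i j
    fin_cases k
    · exact hsep i j
    · have := hsep j i
      change dot (-φ) _ < dot (-φ) _
      rw [hdotneg, hdotneg]
      exact neg_lt_neg this
  have hinj' : ∀ k i j, dot (Φ k) (c k i) = dot (Φ k) (c k j) → i ≡ j [MOD n k] := by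
    intro k i j h
    refine hinj k i j ?_
    fin_cases k
    · exact h
    · change dot (-φ) _ = dot (-φ) _ at h
      rw [hdotneg, hdotneg] at h
      exact neg_injective h
  set σ : Fin 2 → ℕ → ℕ → ℝ := fun k i j => lineSlope (rot (Φ k) (c k i)) (rot (Φ k) (c (1 - k) j))
    with hσ
  have hσsymm : ∀ k i j, σ (1 - k) j i = σ k i j := by
    intro k i j
    simp only [hσ]
    rw [hneg, one_sub_one_sub, rot_neg, rot_neg, lineSlope_neg, lineSlope_symm]
  have hσlt : ∀ k i i' j, σ k i j < σ k i' j ↔ orient (c (1 - k) j) (c k i) (c k i') = 1 := by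
    intro k i i' j
    simp only [hσ]
    rw [lineSlope_lt_iff (hlt k i j) (hlt k i' j), cross_rot, orient_eq_one_iff]
    exact mul_pos_iff_of_pos_left (normSq_pos (hΦ0 k))
  have hnpos : ∀ k, 0 < n k := fun k => Nat.pos_of_ne_zero (NeZero.ne _)
  -- The line of largest slope is the tangent towards which the algorithm moves; it supplies the
  -- reference index `r` for both polygons.
  obtain ⟨⟨r₀, r₁⟩, hr, hmax⟩ := (Finset.range (n 0) ×ˢ Finset.range (n 1)).exists_max_image
    (fun x => σ 0 x.1 x.2) ⟨(0, 0), by simp [hnpos]⟩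
  rw [Finset.mem_product, Finset.mem_range, Finset.mem_range] at hr
  set m := σ 0 r₀ r₁ with hm
  have hmax0 : ∀ i j, σ 0 i j ≤ m := by
    intro i j
    have := hmax (i % n 0, j % n 1) (by simp [Nat.mod_lt _ (hnpos _)])
    have h1 : c 0 (i % n 0) = c 0 i := corner_congr _ (Nat.mod_modEq _ _)
    have h2 : c 1 (j % n 1) = c 1 j := corner_congr _ (Nat.mod_modEq _ _)
    simp only [hσ] at this ⊢
    rw [show (1 : Fin 2) - 0 = 1 from rfl] at this ⊢
    rwa [h1, h2] at this
  set R : Fin 2 → ℕ := ![r₀, r₁] with hR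
  have hmaxk : ∀ k i j, σ k i j ≤ m := by
    intro k i j
    fin_cases k
    · exact hmax0 i j
    · have := hmax0 j i
      rw [← hσsymm] at this
      exact this
  have hattain : ∀ k, σ k (R k) (R (1 - k)) = m := by
    intro k
    fin_cases k
    · rfl
    · exact hσsymm 0 r₀ r₁
  have hRlt : ∀ k, R k < n k := by
    intro k
    fin_cases k
    · exact hr.1
    · exact hr.2
  have O : ∀ k, Observed (n k) (fun i => rot (Φ k) (c k i)) (rot (Φ k) '' Set.range (c (1 - k)))
      (R k) m := by
    intro k
    refine observed_of_slope_max (hP k) (hccw k) ?_ (hΦ0 k) (hinj' k) ?_ ?_ ?_ (hRlt k)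
      (q₀ := c (1 - k) (R (1 - k))) ⟨_, rfl⟩ (hattain k)
    · intro i j l h1 h2 h3
      exact hgp.cross_ne_zero ((hP k).corner_ne h1) ((hP k).corner_ne h2) ((hP k).corner_ne h3)
    · rintro _ ⟨j, rfl⟩ i
      exact hlt k i j
    · rintro _ ⟨l, rfl⟩ i j h
      exact hgp.cross_ne_zero (hgp.corner_ne k l i) ((hP k).corner_ne h) (hgp.corner_ne k l j)
    · rintro _ ⟨j, rfl⟩ i
      exact hmaxk k i j
  refine ⟨fun k s j => Bounded (n k) (fun i => rot (Φ k) (c k i))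
    (rot (Φ k) '' Set.range (c (1 - k))) (R k) s (rot (Φ k) (c (1 - k) j)),
    fun k j => Or.inl (Nat.zero_le _), fun k s t j hB hchain ht => ?_, fun k s t j hB ht => ?_,
    fun k s j hB => ?_⟩
  · refine (O k).bounded_advance ⟨_, ⟨j, rfl⟩, rfl⟩ hB (fun i hi hi' => ?_) ((hσlt k s t j).2 ht)
    exact not_lt.1 fun h => hchain i hi hi' ((hσlt k s i j).1 h)
  -- For the polygon `1 - k` a move of `s` is a move of its observer, and by the symmetry of `σ` it
  -- raises the line.
  · refine hB.of_slope_le ?_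
    have h1 := (hσlt k s t j).2 ht
    rw [← hσsymm k s j, ← hσsymm k t j] at h1
    exact h1.le
  -- Both alternatives give `s ≤ R k + n k`, and `R k < n k`.
  · have := hRlt k
    rcases hB with h | h
    · omega
    · have := h.1
      omega

end Pair

/-! ### Lines and half-planes -/

lemma cross_swap (a b c : Plane) : cross b a c = - cross a b c := by
  unfold cross
  ring

lemma cross_self_left (a b : Plane) : cross a b a = 0 := by
  unfold cross
  ring

lemma cross_self_right (a b : Plane) : cross a b b = 0 := by
  unfold cross
  ring

lemma cross_combo (a b x y : Plane) {α β : ℝ} (h : α + β = 1) :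
    cross a b (α • x + β • y) = α * cross a b x + β * cross a b y := by
  obtain rfl : β = 1 - α := by linarith
  simp only [cross, Prod.fst_add, Prod.snd_add, Prod.smul_fst, Prod.smul_snd, smul_eq_mul]
  ring

lemma convex_LHP (a b : Plane) : Convex ℝ (LHP a b) := by
  intro x hx y hy α β hα hβ h
  rw [mem_LHP_iff] at *
  rw [cross_combo a b x y h]
  positivity

/-- An open half-plane together with a point of its border is convex. -/
lemma convex_insert_openHalfPlane {a b p : Plane} (hp : cross a b p = 0) :
    Convex ℝ {x | 0 < cross a b x ∨ x = p} := by
  intro x hx y hy α β hα hβ h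
  rcases hα.eq_or_lt with rfl | hα'
  · obtain rfl : β = 1 := by linarith
    simpa using hy
  rcases hβ.eq_or_lt with rfl | hβ'
  · obtain rfl : α = 1 := by linarith
    simpa using hx
  rcases hx with hx | rfl
  · left
    rw [cross_combo a b x y h]
    have : 0 ≤ cross a b y := by
      rcases hy with hy | rfl
      · exact hy.le
      · exact hp.ge
    positivity
  · rcases hy with hy | rfl
    · left
      rw [cross_combo a b x y h, hp]
      positivity
    · right
      rw [← add_smul, h, one_smul]

lemma mem_lineThrough_iff_exists {a b x : Plane} :
    x ∈ lineThrough a b ↔ ∃ t : ℝ, x = a + t • (b - a) := by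
  unfold lineThrough
  rw [SetLike.mem_coe, mem_affineSpan_pair_iff_exists_lineMap_eq]
  refine exists_congr fun t => ?_
  rw [AffineMap.lineMap_apply, vsub_eq_sub, vadd_eq_add, add_comm]
  exact eq_comm

lemma cross_eq_zero_of_mem_lineThrough {a b x : Plane} (h : x ∈ lineThrough a b) :
    cross a b x = 0 := by
  obtain ⟨t, rfl⟩ := mem_lineThrough_iff_exists.1 h
  simp only [cross, Prod.fst_add, Prod.snd_add, Prod.smul_fst, Prod.smul_snd, smul_eq_mul,
    Prod.fst_sub, Prod.snd_sub]
  ring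

lemma left_mem_lineThrough (a b : Plane) : a ∈ lineThrough a b :=
  left_mem_affineSpan_pair ℝ a b

lemma right_mem_lineThrough (a b : Plane) : b ∈ lineThrough a b :=
  right_mem_affineSpan_pair ℝ a b

lemma lineThrough_comm (a b : Plane) : lineThrough a b = lineThrough b a := by
  unfold lineThrough
  rw [Set.pair_comm]

/-- Two pairs of points on the same line define the same orientations up to a factor. -/
lemma exists_cross_eq_mul {a b a' b' : Plane} (ha : a' ∈ lineThrough a b)
    (hb : b' ∈ lineThrough a b) (hne : a' ≠ b') :
    ∃ r : ℝ, r ≠ 0 ∧ ∀ x, cross a' b' x = r * cross a b x := by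
  obtain ⟨t, rfl⟩ := mem_lineThrough_iff_exists.1 ha
  obtain ⟨t', rfl⟩ := mem_lineThrough_iff_exists.1 hb
  refine ⟨t' - t, fun h => hne ?_, fun x => ?_⟩
  · rw [sub_eq_zero.1 h]
  · simp only [cross, Prod.fst_add, Prod.snd_add, Prod.smul_fst, Prod.smul_snd, smul_eq_mul,
      Prod.fst_sub, Prod.snd_sub]
    ring

lemma cross_eq_zero_of_cross_eq_zero {a b x y z : Plane} (hab : a ≠ b) (hx : cross a b x = 0)
    (hy : cross a b y = 0) (hz : cross a b z = 0) : cross x y z = 0 := by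
  by_contra h
  apply hab
  unfold cross at *
  have h1 : (b.1 - a.1) * ((y.1 - x.1) * (z.2 - x.2) - (y.2 - x.2) * (z.1 - x.1)) = 0 := by
    linear_combination (y.1 - x.1) * (hz - hx) - (z.1 - x.1) * (hy - hx)
  have h2 : (b.2 - a.2) * ((y.1 - x.1) * (z.2 - x.2) - (y.2 - x.2) * (z.1 - x.1)) = 0 := by
    linear_combination (y.2 - x.2) * (hz - hx) - (z.2 - x.2) * (hy - hx)
  ext
  · linarith [(mul_eq_zero.1 h1).resolve_right h]
  · linarith [(mul_eq_zero.1 h2).resolve_right h]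

section Pair

variable {n : Fin 2 → ℕ} [∀ k, NeZero (n k)] {P : (k : Fin 2) → Polygon Plane (n k)}

/-- Two polygons on opposite sides of a line that they touch in different corners. -/
lemma disjoint_convexHull_of_line {a b p q : Plane} (hp : cross a b p = 0) (hq : cross a b q = 0)
    (hpq : p ≠ q) (h0 : ∀ i, 0 < cross a b (corner (P 0) i) ∨ corner (P 0) i = p)
    (h1 : ∀ i, cross a b (corner (P 1) i) < 0 ∨ corner (P 1) i = q) :
    Disjoint (convexHull ℝ ((P 0).boundary ℝ)) (convexHull ℝ ((P 1).boundary ℝ)) := by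
  have hq' : cross b a q = 0 := by rw [cross_swap, hq, neg_zero]
  have hsub0 : convexHull ℝ ((P 0).boundary ℝ) ⊆ {x | 0 < cross a b x ∨ x = p} :=
    convexHull_min (boundary_subset_of_convex _ (convex_insert_openHalfPlane hp) h0)
      (convex_insert_openHalfPlane hp)
  have hsub1 : convexHull ℝ ((P 1).boundary ℝ) ⊆ {x | 0 < cross b a x ∨ x = q} :=
    convexHull_min (boundary_subset_of_convex _ (convex_insert_openHalfPlane hq') fun i => by
      rcases h1 i with h | h
      · left
        rw [cross_swap]
        exact neg_pos.2 h
      · exact Or.inr h) (convex_insert_openHalfPlane hq')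
  refine Set.disjoint_left.2 fun x hx0 hx1 => ?_
  rcases hsub0 hx0 with h | rfl <;> rcases hsub1 hx1 with h' | rfl
  · rw [cross_swap] at h'
    linarith
  · exact h.ne' hq
  · rw [cross_swap, hp, neg_zero] at h'
    exact lt_irrefl _ h'
  · exact hpq rfl

/-- An affine function that is nonnegative at both ends of an edge and vanishes on the edge vanishes
at an end with nonzero weight. -/
lemma exists_corner_of_tangent {m : ℕ} [NeZero m] {R : Polygon Plane m} {a b : Plane}
    (hmeet : (lineThrough a b ∩ R.boundary ℝ).Nonempty)
    (hside : ∀ i, 0 ≤ cross a b (corner R i)) : ∃ i, cross a b (corner R i) = 0 := by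
  obtain ⟨x, hx, hxR⟩ := hmeet
  rw [boundary_eq, Set.mem_iUnion] at hxR
  obtain ⟨i, α, β, hα, hβ, h, rfl⟩ := hxR
  have h0 := cross_eq_zero_of_mem_lineThrough hx
  rw [cross_combo a b _ _ h] at h0
  have h1 := mul_nonneg hα (hside i)
  have h2 := mul_nonneg hβ (hside (i + 1))
  rcases mul_eq_zero.1 (show α * cross a b (corner R i) = 0 by linarith) with h3 | h3
  · refine ⟨i + 1, (mul_eq_zero.1 (show β * cross a b (corner R (i + 1)) = 0 by linarith)
      ).resolve_left ?_⟩
    intro h4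
    linarith
  · exact ⟨i, h3⟩

/-- Polygons with a separating common tangent have disjoint convex hulls. -/
lemma disjoint_of_separating (hgp : GeneralPosition P) {ℓ : Set Plane}
    (h : IsSeparatingCommonTangent ℓ ((P 0).boundary ℝ) ((P 1).boundary ℝ)) :
    Disjoint (convexHull ℝ ((P 0).boundary ℝ)) (convexHull ℝ ((P 1).boundary ℝ)) := by
  obtain ⟨hct, hno⟩ := h
  obtain ⟨⟨hm0, a, b, hab, rfl, hs0⟩, ⟨hm1, a', b', hab', hl, hs1⟩⟩ := id hct
  have ha' : a' ∈ lineThrough a b := hl ▸ left_mem_lineThrough a' b'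
  have hb' : b' ∈ lineThrough a b := hl ▸ right_mem_lineThrough a' b'
  obtain ⟨r, hr0, hr⟩ := exists_cross_eq_mul ha' hb' hab'
  -- With equal signs both polygons would be on the same side, and the tangent would be an outer
  -- one.
  have hrneg : r < 0 := by
    by_contra hc
    have hrpos : 0 < r := lt_of_le_of_ne (not_lt.1 hc) hr0.symm
    refine hno ⟨hct, a, b, hab, rfl, hs0, fun x hx => ?_⟩
    have := mem_LHP_iff.1 (hs1 hx)
    rw [hr] at this
    exact mem_LHP_iff.2 (nonneg_of_mul_nonneg_right this hrpos)
  have hc0 : ∀ i, 0 ≤ cross a b (corner (P 0) i) := fun i =>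
    mem_LHP_iff.1 (hs0 (corner_mem_boundary _ i))
  have hc1 : ∀ i, 0 ≤ cross a' b' (corner (P 1) i) := fun i =>
    mem_LHP_iff.1 (hs1 (corner_mem_boundary _ i))
  obtain ⟨i₀, hi₀⟩ := exists_corner_of_tangent hm0 hc0
  rw [hl] at hm1
  obtain ⟨j₀, hj₀⟩ := exists_corner_of_tangent hm1 hc1
  have hj₀' : cross a b (corner (P 1) j₀) = 0 := by
    rw [hr] at hj₀
    exact (mul_eq_zero.1 hj₀).resolve_left hr0
  have hne : ∀ i j, corner (P 0) i ≠ corner (P 1) j := fun i j => hgp.corner_ne 1 i j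
  -- A further corner on the line would be collinear with the two corners in which the line touches
  -- the polygons.
  refine disjoint_convexHull_of_line hi₀ hj₀' (hne _ _) (fun i => ?_) (fun i => ?_)
  · by_cases hi : corner (P 0) i = corner (P 0) i₀
    · exact Or.inr hi
    · refine Or.inl (lt_of_le_of_ne (hc0 i) fun h0 => ?_)
      exact hgp.cross_ne_zero hi (hne i₀ j₀) (hne i j₀)
        (cross_eq_zero_of_cross_eq_zero hab h0.symm hi₀ hj₀')
  · by_cases hi : corner (P 1) i = corner (P 1) j₀
    · exact Or.inr hi
    · refine Or.inl (lt_of_le_of_ne ?_ fun h0 => ?_)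
      · have := hc1 i
        rw [hr] at this
        exact nonpos_of_mul_nonneg_right this hrneg
      · exact hgp.cross_ne_zero hi (hne i₀ j₀).symm (hne i₀ i).symm
          (cross_eq_zero_of_cross_eq_zero hab h0 hj₀' hi₀)

/-! ### Tangent pairs of corners -/

/-- A pair of corners such that each polygon is to the right of the line to its own corner. -/
def IsTangentPair (P : (k : Fin 2) → Polygon Plane (n k)) (s : Fin 2 → ℕ) : Prop :=
  ∀ k i, orient (corner (P (1 - k)) (s (1 - k))) (corner (P k) (s k)) (corner (P k) i) ≠ 1

namespace IsTangentPair

variable {s : Fin 2 → ℕ}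

lemma cross_nonneg (hs : IsTangentPair P s) (k : Fin 2) (i : ℕ) :
    0 ≤ cross (corner (P k) (s k)) (corner (P (1 - k)) (s (1 - k))) (corner (P k) i) := by
  have := hs k i
  rw [Ne, orient_eq_one_iff, cross_swap] at this
  linarith

lemma subset_RHP (hs : IsTangentPair P s) (k : Fin 2) :
    (P k).boundary ℝ ⊆ RHP (corner (P (1 - k)) (s (1 - k))) (corner (P k) (s k)) :=
  boundary_subset_of_convex _ (convex_LHP _ _) fun i => mem_LHP_iff.2 (hs.cross_nonneg k i)

lemma cross_pos (hs : IsTangentPair P s) (hgp : GeneralPosition P) (k : Fin 2) (i : ℕ)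
    (hi : corner (P k) i ≠ corner (P k) (s k)) :
    0 < cross (corner (P k) (s k)) (corner (P (1 - k)) (s (1 - k))) (corner (P k) i) :=
  lt_of_le_of_ne (hs.cross_nonneg k i)
    (hgp.cross_ne_zero (hgp.corner_ne k _ _).symm (hgp.corner_ne k _ _) hi.symm).symm

lemma disjoint_convexHull (hs : IsTangentPair P s) (hgp : GeneralPosition P) :
    Disjoint (convexHull ℝ ((P 0).boundary ℝ)) (convexHull ℝ ((P 1).boundary ℝ)) := by
  refine disjoint_convexHull_of_line (a := corner (P 0) (s 0)) (b := corner (P 1) (s 1))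
    (cross_self_left _ _) (cross_self_right _ _) (hgp.corner_ne 1 _ _) (fun i => ?_) fun i => ?_
  · by_cases hi : corner (P 0) i = corner (P 0) (s 0)
    · exact Or.inr hi
    · exact Or.inl (hs.cross_pos hgp 0 i hi)
  · by_cases hi : corner (P 1) i = corner (P 1) (s 1)
    · exact Or.inr hi
    · left
      have := hs.cross_pos hgp 1 i hi
      rw [cross_swap] at this
      exact neg_pos.1 this

lemma isSeparatingCommonTangent (hs : IsTangentPair P s) (hP : ∀ k, IsSimple (P k))
    (hgp : GeneralPosition P) :
    IsSeparatingCommonTangent (lineThrough (corner (P 0) (s 0)) (corner (P 1) (s 1)))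
      ((P 0).boundary ℝ) ((P 1).boundary ℝ) := by
  have hne : corner (P 0) (s 0) ≠ corner (P 1) (s 1) := hgp.corner_ne 1 _ _
  refine ⟨⟨⟨⟨_, left_mem_lineThrough _ _, corner_mem_boundary _ _⟩, _, _, hne, rfl,
    hs.subset_RHP 0⟩, ⟨⟨_, right_mem_lineThrough _ _, corner_mem_boundary _ _⟩, _, _, hne.symm,
    lineThrough_comm _ _, hs.subset_RHP 1⟩⟩, ?_⟩
  rintro ⟨-, a, b, hab, hl, h0, h1⟩
  have ha : a ∈ lineThrough (corner (P 0) (s 0)) (corner (P 1) (s 1)) :=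
    hl ▸ left_mem_lineThrough a b
  have hb : b ∈ lineThrough (corner (P 0) (s 0)) (corner (P 1) (s 1)) :=
    hl ▸ right_mem_lineThrough a b
  obtain ⟨r, hr0, hr⟩ := exists_cross_eq_mul ha hb hab
  -- The corners next to the two contact corners lie strictly on opposite sides, so an outer tangent
  -- would need both `0 ≤ r` and `r ≤ 0`.
  have hnext : ∀ k, corner (P k) (s k + 1) ≠ corner (P k) (s k) := fun k =>
    ((hP k).corner_ne (not_modEq_of_lt (Nat.lt_succ_self _)
      (by have := (hP k).three_le; omega))).symm
  have e0 := mem_LHP_iff.1 (h0 (corner_mem_boundary _ (s 0 + 1)))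
  have e1 := mem_LHP_iff.1 (h1 (corner_mem_boundary _ (s 1 + 1)))
  have f0 := hs.cross_pos hgp 0 _ (hnext 0)
  have f1 := hs.cross_pos hgp 1 _ (hnext 1)
  rw [cross_swap] at f1
  rw [hr] at e0 e1
  have g0 : 0 ≤ r := nonneg_of_mul_nonneg_left e0 f0
  have g1 : r ≤ 0 := nonpos_of_mul_nonneg_left e1 (neg_pos.1 f1)
  exact hr0 (le_antisymm g1 g0)

end IsTangentPair

end Pair

/-! ### Execution of the program -/

/-- The workspace that holds `s 0, s 1, t 0, t 1, u`. -/
def mem (s t : Fin 2 → ℕ) (u : Fin 2) : Fin algWords → ℕ := ![s 0, s 1, t 0, t 1, u]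

section Machine

variable {n : Fin 2 → ℕ} [∀ k, NeZero (n k)] (P : (k : Fin 2) → Polygon Plane (n k))

lemma run_succ (prog : Program) (w j : ℕ) : run P prog w (j + 1) = step P prog (run P prog w j) :=
  Function.iterate_succ_apply' _ _ _

lemma inputCorner_zero (i : ℕ) : inputCorner P 0 i = corner (P 0) i := rfl

lemma inputCorner_one (i : ℕ) : inputCorner P 1 i = corner (P 1) i := rfl

/-- The test of the loop body. -/
def Left (s t : Fin 2 → ℕ) (u : Fin 2) : Prop :=
  orient (corner (P (1 - u)) (s (1 - u))) (corner (P u) (s u)) (corner (P u) (t u)) = 1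

lemma run_five : run P separatingCommonTangent algWords 5 = .running 5 (mem 0 1 0) := by
  change run P separatingCommonTangent algWords (0 + 1 + 1 + 1 + 1 + 1) = _
  have h0 : run P separatingCommonTangent algWords 0 = .running 0 fun _ => 0 := rfl
  rw [run_succ, run_succ, run_succ, run_succ, run_succ, h0]
  simp only [step, separatingCommonTangent, Instr.exec, NExp.eval, Alg.sAddr, Alg.tAddr, Alg.uAddr,
    List.getElem?_cons_zero, List.getElem?_cons_succ]
  congr 1
  funext a
  fin_cases a <;> simp [mem, algWords]

variable (s t : Fin 2 → ℕ) (u : Fin 2)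

open Classical in
lemma step_loop : step P separatingCommonTangent (.running 5 (mem s t u)) =
    .running (if t 0 < 3 * n 0 ∨ t 1 < 3 * n 1 then 6 else 14) (mem s t u) := by
  simp only [step, separatingCommonTangent, Instr.exec, Test.Holds, NExp.eval, Alg.t, Alg.tAddr,
    List.getElem?_cons_zero, List.getElem?_cons_succ]
  simp [mem, algWords]

open Classical in
lemma step_left : step P separatingCommonTangent (.running 6 (mem s t u)) =
    .running (if Left P s t u then 7 else 11) (mem s t u) := by
  simp only [step, separatingCommonTangent, Instr.exec, List.getElem?_cons_zero,
    List.getElem?_cons_succ]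
  congr 2
  rw [Left, orient_eq_one_iff, eq_iff_iff, cross]
  simp only [Alg.leftTest, Test.Holds, RExp.eval, NExp.eval, Alg.u', Alg.u, Alg.s, Alg.t, Alg.sAddr,
    Alg.tAddr, Alg.uAddr]
  fin_cases u <;> simp [mem, algWords, inputCorner_zero, inputCorner_one] <;>
    constructor <;> intro h <;> nlinarith

open Classical in
lemma step_bound : step P separatingCommonTangent (.running 7 (mem s t u)) =
    .running (if t u < 2 * n u then 9 else 8) (mem s t u) := by
  simp only [step, separatingCommonTangent, Instr.exec, Test.Holds, NExp.eval, Alg.t, Alg.tAddr,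
    Alg.u, Alg.uAddr, List.getElem?_cons_zero, List.getElem?_cons_succ]
  fin_cases u <;> simp [mem, algWords]

lemma step_null (m : Fin algWords → ℕ) :
    step P separatingCommonTangent (.running 8 m) = .halted none := by
  simp only [step, separatingCommonTangent, Instr.exec, List.getElem?_cons_zero,
    List.getElem?_cons_succ]

lemma step_store_s : step P separatingCommonTangent (.running 9 (mem s t u)) =
    .running 10 (mem (Function.update s u (t u)) t u) := by
  simp only [step, separatingCommonTangent, Instr.exec, NExp.eval, Alg.t, Alg.tAddr, Alg.sAddr,
    Alg.u, Alg.uAddr, List.getElem?_cons_zero, List.getElem?_cons_succ]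
  congr 1
  funext a
  fin_cases u <;> fin_cases a <;> simp [mem, algWords]

lemma step_reset_t : step P separatingCommonTangent (.running 10 (mem s t u)) =
    .running 11 (mem s (Function.update t (1 - u) (s (1 - u) + 1)) u) := by
  simp only [step, separatingCommonTangent, Instr.exec, NExp.eval, Alg.s, Alg.tAddr, Alg.sAddr,
    Alg.u, Alg.u', Alg.uAddr, List.getElem?_cons_zero, List.getElem?_cons_succ]
  congr 1
  funext a
  fin_cases u <;> fin_cases a <;> simp [mem, algWords]

lemma step_incr_t : step P separatingCommonTangent (.running 11 (mem s t u)) =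
    .running 12 (mem s (Function.update t u (t u + 1)) u) := by
  simp only [step, separatingCommonTangent, Instr.exec, NExp.eval, Alg.t, Alg.tAddr,
    Alg.u, Alg.uAddr, List.getElem?_cons_zero, List.getElem?_cons_succ]
  congr 1
  funext a
  fin_cases u <;> fin_cases a <;> simp [mem, algWords]

lemma step_flip_u : step P separatingCommonTangent (.running 12 (mem s t u)) =
    .running 13 (mem s t (1 - u)) := by
  simp only [step, separatingCommonTangent, Instr.exec, NExp.eval, Alg.u', Alg.u, Alg.uAddr,
    List.getElem?_cons_zero, List.getElem?_cons_succ]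
  congr 1
  funext a
  fin_cases u <;> fin_cases a <;> simp [mem, algWords]

lemma step_goto (m : Fin algWords → ℕ) :
    step P separatingCommonTangent (.running 13 m) = .running 5 m := by
  simp only [step, separatingCommonTangent, Instr.exec, List.getElem?_cons_zero,
    List.getElem?_cons_succ]

lemma step_return : step P separatingCommonTangent (.running 14 (mem s t u)) =
    .halted (some (s 0, s 1)) := by
  simp only [step, separatingCommonTangent, Instr.exec, NExp.eval, Alg.s, Alg.sAddr,
    List.getElem?_cons_zero, List.getElem?_cons_succ]
  simp [mem, algWords]

end Machine

/-! ### Size of the workspace -/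

/-- All words of the workspace are at most `W`. -/
def State.WordsLE {w : ℕ} (W : ℕ) : State w → Prop
  | .halted _ => True
  | .running _ m => ∀ a, m a ≤ W

lemma wordsLE_mem {l W : ℕ} {s t : Fin 2 → ℕ} {u : Fin 2} (hs : ∀ k, s k ≤ W) (ht : ∀ k, t k ≤ W)
    (hW : 1 ≤ W) : (State.running l (mem s t u)).WordsLE W := by
  have hu : (u : ℕ) ≤ W := by have := u.isLt; omega
  intro a
  fin_cases a
  · exact hs 0
  · exact hs 1
  · exact ht 0
  · exact ht 1
  · exact hu

lemma bits_le {w W b : ℕ} {σ : State w} (h : σ.WordsLE W) (hW : W < 2 ^ b) : σ.bits ≤ w * b := by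
  cases σ with
  | halted _ => exact Nat.zero_le _
  | running l m =>
    refine (Finset.sum_le_card_nsmul _ _ b fun a _ => ?_).trans (by simp)
    exact Nat.size_le.2 ((h a).trans_lt hW)

lemma forall_fin_two_iff {p : Fin 2 → Prop} (u : Fin 2) : (∀ k, p k) ↔ p u ∧ p (1 - u) := by
  constructor
  · exact fun h => ⟨h _, h _⟩
  · rintro ⟨h1, h2⟩ k
    fin_cases u <;> fin_cases k <;> assumption

lemma one_sub_ne (u : Fin 2) : 1 - u ≠ u := by
  fin_cases u <;> decide

lemma orient_right (a b : Plane) : orient a b b ≠ 1 := by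
  rw [Ne, orient_eq_one_iff, cross_self_right]
  exact lt_irrefl _

/-- An upper bound for the words of the workspace. -/
def wordBound (n : Fin 2 → ℕ) : ℕ := 6 * (n 0 + n 1)

lemma wordBound_eq {n : Fin 2 → ℕ} (u : Fin 2) : wordBound n = 6 * (n u + n (1 - u)) := by
  unfold wordBound
  fin_cases u
  · rfl
  · exact congrArg (6 * ·) (add_comm _ _)

lemma loop_condition_iff {n : Fin 2 → ℕ} (t : Fin 2 → ℕ) (u : Fin 2) :
    t 0 < 3 * n 0 ∨ t 1 < 3 * n 1 ↔ t u < 3 * n u ∨ t (1 - u) < 3 * n (1 - u) := by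
  fin_cases u
  · exact Iff.rfl
  · exact or_comm

/-- With `L` the logarithm of `N = n 0 + n 1`, `6 * N < 8 * 2 ^ (L + 1) = 2 ^ (L + 4)`, and `L ≥ 2`
because `N ≥ 4`. -/
lemma wordBound_lt {n : Fin 2 → ℕ} (h : 6 ≤ n 0 + n 1) :
    wordBound n < 2 ^ (3 * Nat.log 2 (n 0 + n 1)) := by
  have h1 : n 0 + n 1 < 2 ^ (Nat.log 2 (n 0 + n 1) + 1) := Nat.lt_pow_succ_log_self (by norm_num) _
  have h2 : 2 ≤ Nat.log 2 (n 0 + n 1) := Nat.le_log_of_pow_le (by norm_num) (by omega)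
  have h3 : 2 ^ (Nat.log 2 (n 0 + n 1) + 1) * 2 ^ 3 ≤ 2 ^ (3 * Nat.log 2 (n 0 + n 1)) := by
    rw [← pow_add]
    exact Nat.pow_le_pow_right (by norm_num) (by omega)
  unfold wordBound
  omega

/-! ### The loop: invariant, termination and cost -/

section Loop

variable {n : Fin 2 → ℕ} [∀ k, NeZero (n k)] (P : (k : Fin 2) → Polygon Plane (n k))

lemma stepCost_le {w : ℕ} (σ : State w) : σ.stepCost separatingCommonTangent ≤ 100 := by
  cases σ with
  | halted _ => exact Nat.zero_le _
  | running l m =>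
    have hall : ∀ I ∈ separatingCommonTangent, I.cost ≤ 100 := by
      simp [separatingCommonTangent, Instr.cost, Test.cost, NExp.cost, RExp.cost, Alg.leftTest,
        Alg.s, Alg.t, Alg.u, Alg.u', Alg.sAddr, Alg.tAddr, Alg.uAddr]
    simp only [State.stepCost]
    cases h : separatingCommonTangent[l]? with
    | none => exact Nat.le_of_lt (by decide)
    | some I => exact hall I (List.mem_of_getElem? h)

lemma runTime_le (w j : ℕ) : runTime P separatingCommonTangent w j ≤ 100 * j := by
  unfold runTime
  refine (Finset.sum_le_card_nsmul _ _ 100 fun i _ => stepCost_le _).trans ?_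
  simp [mul_comm]

lemma visits_succ (w l j : ℕ) (h : ¬ (run P separatingCommonTangent w j).AtLine l) :
    visits P separatingCommonTangent w l (j + 1) = visits P separatingCommonTangent w l j := by
  classical
  unfold visits
  rw [Finset.range_add_one, Finset.filter_insert, if_neg h]

lemma visits_succ_le (w l j : ℕ) : visits P separatingCommonTangent w l (j + 1) ≤
    visits P separatingCommonTangent w l j + 1 := by
  classical
  unfold visits
  rw [Finset.range_add_one, Finset.filter_insert]
  split_ifs
  · exact Finset.card_insert_le _ _
  · exact Nat.le_succ _

/-- After `j` steps, with `I` visits of the loop body, the machine is in the state `σ`, and the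
workspace was small all the time. -/
structure Reaches (j I : ℕ) (σ : State algWords) : Prop where
  run_eq : run P separatingCommonTangent algWords j = σ
  visits_le : visits P separatingCommonTangent algWords loopBodyLine j ≤ I
  wordsLE : ∀ i ≤ j, (run P separatingCommonTangent algWords i).WordsLE (wordBound n)

variable {P}

lemma Reaches.next {j I l : ℕ} {m : Fin algWords → ℕ} {σ : State algWords}
    (h : Reaches P j I (.running l m)) (hl : l ≠ loopBodyLine)
    (hσ : step P separatingCommonTangent (.running l m) = σ) (hw : σ.WordsLE (wordBound n)) :
    Reaches P (j + 1) I σ := by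
  have hrun : run P separatingCommonTangent algWords (j + 1) = σ := by
    rw [run_succ, h.run_eq, hσ]
  refine ⟨hrun, ?_, fun i hi => ?_⟩
  · rw [visits_succ]
    · exact h.visits_le
    · rw [h.run_eq]
      exact hl
  · rcases Nat.lt_or_ge j i with h' | h'
    · rw [show i = j + 1 by omega, hrun]
      exact hw
    · exact h.wordsLE i h'

lemma Reaches.next_visit {j I l : ℕ} {m : Fin algWords → ℕ} {σ : State algWords}
    (h : Reaches P j I (.running l m))
    (hσ : step P separatingCommonTangent (.running l m) = σ) (hw : σ.WordsLE (wordBound n)) :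
    Reaches P (j + 1) (I + 1) σ := by
  have hrun : run P separatingCommonTangent algWords (j + 1) = σ := by
    rw [run_succ, h.run_eq, hσ]
  refine ⟨hrun, (visits_succ_le P _ _ _).trans (Nat.succ_le_succ h.visits_le), fun i hi => ?_⟩
  rcases Nat.lt_or_ge j i with h' | h'
  · rw [show i = j + 1 by omega, hrun]
    exact hw
  · exact h.wordsLE i h'

/-- The invariant of the loop after `I` iterations. -/
structure LoopInvariant (P : (k : Fin 2) → Polygon Plane (n k)) (B : Fin 2 → ℕ → ℕ → Prop) (I : ℕ)
    (s t : Fin 2 → ℕ) (u : Fin 2) : Prop where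
  lt : ∀ k, s k < t k
  lt_two_mul : ∀ k, s k < 2 * n k
  le_bound : ∀ k, t k ≤ wordBound n
  -- The numbers `t k - s k` of tested corners agree, or that of the polygon whose turn it is lags
  -- behind by one.
  balance : t u + s (1 - u) ≤ t (1 - u) + s u
  balance' : t (1 - u) + s u ≤ t u + s (1 - u) + 1
  count : I + 2 ≤ s u + s (1 - u) + t u + t (1 - u)
  not_left : ∀ k i, s k ≤ i → i < t k →
    orient (corner (P (1 - k)) (s (1 - k))) (corner (P k) (s k)) (corner (P k) i) ≠ 1
  bounded : ∀ k, B k (s k) (s (1 - k))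

/-- A property of the indices that is kept by the moves of the algorithm. -/
structure KeptByMoves (P : (k : Fin 2) → Polygon Plane (n k)) (B : Fin 2 → ℕ → ℕ → Prop) :
    Prop where
  zero : ∀ k j, B k 0 j
  advance : ∀ k s t j, B k s j →
    (∀ i, s ≤ i → i < t → orient (corner (P (1 - k)) j) (corner (P k) s) (corner (P k) i) ≠ 1) →
    orient (corner (P (1 - k)) j) (corner (P k) s) (corner (P k) t) = 1 → B k t j
  observe : ∀ k s t j, B (1 - k) j s →
    orient (corner (P (1 - k)) j) (corner (P k) s) (corner (P k) t) = 1 → B (1 - k) j t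

namespace LoopInvariant

variable {B : Fin 2 → ℕ → ℕ → Prop} {I : ℕ} {s t : Fin 2 → ℕ} {u : Fin 2}

/-- While one `t k` is below `3 * n k`, the balance and `s k < 2 * n k` bound the other one too,
hence the sum in `count`. -/
lemma iterations_lt (h : LoopInvariant P B I s t u) (hc : t 0 < 3 * n 0 ∨ t 1 < 3 * n 1) :
    I < wordBound n := by
  rw [loop_condition_iff t u] at hc
  rw [wordBound_eq u]
  have h1 := h.lt_two_mul u
  have h2 := h.lt_two_mul (1 - u)
  have h3 := h.balance
  have h4 := h.balance'
  have h5 := h.count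
  omega

/-- The inequality is strict so that `t k` may still be incremented. -/
lemma t_lt (h : LoopInvariant P B I s t u) (hc : t 0 < 3 * n 0 ∨ t 1 < 3 * n 1) (k : Fin 2) :
    t k < wordBound n := by
  rw [loop_condition_iff t u] at hc
  rw [wordBound_eq u]
  have h1 := h.lt_two_mul u
  have h2 := h.lt_two_mul (1 - u)
  have h3 := h.balance
  have h4 := h.balance'
  revert k
  rw [forall_fin_two_iff u]
  omega

/-- An iteration that does not move `s`. -/
lemma skip (h : LoopInvariant P B I s t u) (hc : t 0 < 3 * n 0 ∨ t 1 < 3 * n 1)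
    (hl : ¬ Left P s t u) :
    LoopInvariant P B (I + 1) s (Function.update t u (t u + 1)) (1 - u) := by
  have hu : Function.update t u (t u + 1) u = t u + 1 := Function.update_self ..
  have hu' : Function.update t u (t u + 1) (1 - u) = t (1 - u) :=
    Function.update_of_ne (one_sub_ne u) ..
  refine ⟨?_, h.lt_two_mul, ?_, ?_, ?_, ?_, ?_, h.bounded⟩
  · rw [forall_fin_two_iff u, hu, hu']
    exact ⟨(h.lt u).trans (Nat.lt_succ_self _), h.lt _⟩
  · rw [forall_fin_two_iff u, hu, hu']
    exact ⟨h.t_lt hc u, h.le_bound _⟩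
  · rw [one_sub_one_sub, hu, hu']
    have := h.balance'
    omega
  · rw [one_sub_one_sub, hu, hu']
    have := h.balance
    omega
  · rw [one_sub_one_sub, hu, hu']
    have := h.count
    omega
  · rw [forall_fin_two_iff u, hu, hu']
    refine ⟨fun i hi hi' => ?_, h.not_left (1 - u)⟩
    rcases Nat.lt_succ_iff_lt_or_eq.1 hi' with h1 | rfl
    · exact h.not_left u i hi h1
    · exact hl

/-- An iteration that moves `s`. -/
lemma move (hB : KeptByMoves P B) (h : LoopInvariant P B I s t u) (hl : Left P s t u)
    (ht : t u < 2 * n u) (hc : t 0 < 3 * n 0 ∨ t 1 < 3 * n 1) :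
    LoopInvariant P B (I + 1) (Function.update s u (t u))
      (Function.update (Function.update t (1 - u) (s (1 - u) + 1)) u (t u + 1)) (1 - u) := by
  set s' := Function.update s u (t u) with hs'
  set t' := Function.update (Function.update t (1 - u) (s (1 - u) + 1)) u (t u + 1) with ht'
  have hsu : s' u = t u := Function.update_self ..
  have hsu' : s' (1 - u) = s (1 - u) := Function.update_of_ne (one_sub_ne u) ..
  have htu : t' u = t u + 1 := Function.update_self ..
  have htu' : t' (1 - u) = s (1 - u) + 1 := by
    rw [ht', Function.update_of_ne (one_sub_ne u), Function.update_self]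
  have hn := wordBound_eq (n := n) u
  have h2 := h.lt_two_mul (1 - u)
  refine ⟨?_, ?_, ?_, ?_, ?_, ?_, ?_, ?_⟩
  · rw [forall_fin_two_iff u, hsu, hsu', htu, htu']
    omega
  · rw [forall_fin_two_iff u, hsu, hsu']
    exact ⟨ht, h2⟩
  · rw [forall_fin_two_iff u, htu, htu']
    have := h.t_lt hc u
    omega
  · rw [one_sub_one_sub, hsu, hsu', htu, htu']
    omega
  · rw [one_sub_one_sub, hsu, hsu', htu, htu']
    omega
  · rw [one_sub_one_sub, hsu, hsu', htu, htu']
    have := h.count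
    -- The sum of the four indices grows by `2 - ((t (1 - u) - s (1 - u)) - (t u - s u))`, which is
    -- at least `1`.
    have := h.balance'
    omega
  · rw [forall_fin_two_iff u, hsu, hsu', htu, htu']
    -- The line has changed, so earlier tests are void and both windows shrink to the single index
    -- `s k`.
    refine ⟨fun i hi hi' => ?_, fun i hi hi' => ?_⟩
    · obtain rfl : i = t u := by omega
      exact orient_right _ _
    · obtain rfl : i = s (1 - u) := by omega
      exact orient_right _ _
  · rw [forall_fin_two_iff u, one_sub_one_sub, hsu, hsu']
    refine ⟨hB.advance u (s u) (t u) _ (h.bounded u) (h.not_left u) hl,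
      hB.observe u (s u) (t u) _ ?_ hl⟩
    have := h.bounded (1 - u)
    rwa [one_sub_one_sub] at this

/-- At the end of the loop all corners were tested. -/
lemma isTangentPair (h : LoopInvariant P B I s t u)
    (hc : ¬ (t 0 < 3 * n 0 ∨ t 1 < 3 * n 1)) : IsTangentPair P s := by
  have hc' : ∀ k, 3 * n k ≤ t k := by
    rw [forall_fin_two_iff 0]
    push Not at hc
    exact hc
  intro k i
  have h1 := hc' k
  have h2 := h.lt_two_mul k
  -- The window from `s k < 2 * n k` to `t k ≥ 3 * n k` contains a full round of indices.
  obtain ⟨i', hi', h3, h4⟩ := exists_modEq_Ico (by omega : 0 < n k) (s k) i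
  rw [← corner_congr (P k) hi']
  exact h.not_left k i' h3 (by omega)

end LoopInvariant

/-- The outcome of the loop. -/
structure Outcome (P : (k : Fin 2) → Polygon Plane (n k)) (B : Fin 2 → ℕ → ℕ → Prop) (T : ℕ)
    (output : Option (ℕ × ℕ)) : Prop where
  reaches : ∃ I ≤ wordBound n, Reaches P T I (.halted output)
  time_le : T ≤ 8 * wordBound n + 8
  tangent : ∀ s₀ s₁, output = some (s₀, s₁) → IsTangentPair P ![s₀, s₁]
  null : output = none → ∃ k s j, B k s j ∧ 2 * n k ≤ s

lemma one_le_wordBound (n : Fin 2 → ℕ) [∀ k, NeZero (n k)] : 1 ≤ wordBound n := by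
  have : n 0 ≠ 0 := NeZero.ne _
  unfold wordBound
  omega

lemma exists_outcome_of_exit {B : Fin 2 → ℕ → ℕ → Prop} {j I : ℕ} {s t : Fin 2 → ℕ} {u : Fin 2}
    (hj : j ≤ 8 * I + 5) (hI : I ≤ wordBound n) (hR : Reaches P j I (.running 5 (mem s t u)))
    (hinv : LoopInvariant P B I s t u) (hc : ¬ (t 0 < 3 * n 0 ∨ t 1 < 3 * n 1)) :
    ∃ T output, Outcome P B T output := by
  classical
  have hsW : ∀ k, s k ≤ wordBound n := fun k => (hinv.lt k).le.trans (hinv.le_bound k)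
  have h1 := hR.next (by decide) (step_loop P s t u)
    (wordsLE_mem hsW hinv.le_bound (one_le_wordBound n))
  rw [if_neg hc] at h1
  have h2 := h1.next (by decide) (step_return P s t u) trivial
  refine ⟨_, _, ⟨I, hI, h2⟩, by omega, fun s₀ s₁ h => ?_, fun h => by cases h⟩
  have hs : ![s₀, s₁] = s := by
    simp only [Option.some.injEq, Prod.mk.injEq] at h
    funext k
    fin_cases k
    · exact h.1.symm
    · exact h.2.symm
  rw [hs]
  exact hinv.isTangentPair hc

/-- Induction on the number `d` of iterations still allowed. In `8 * I + 5` the `5` counts the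
initial stores and the `8` the instructions of an iteration that moves `s`. -/
lemma exists_outcome_of_reaches {B : Fin 2 → ℕ → ℕ → Prop} (hB : KeptByMoves P B) (d : ℕ) :
    ∀ (j I : ℕ) (s t : Fin 2 → ℕ) (u : Fin 2), wordBound n ≤ I + d → j ≤ 8 * I + 5 →
      I ≤ wordBound n → Reaches P j I (.running 5 (mem s t u)) → LoopInvariant P B I s t u →
      ∃ T output, Outcome P B T output := by
  classical
  have hNpos := one_le_wordBound n
  induction d with
  | zero =>
    intro j I s t u hd hj hI hR hinv
    have hc : ¬ (t 0 < 3 * n 0 ∨ t 1 < 3 * n 1) := fun hc => by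
      have := hinv.iterations_lt hc
      omega
    exact exists_outcome_of_exit hj hI hR hinv hc
  | succ d ih =>
    intro j I s t u hd hj hI hR hinv
    have hsW : ∀ k, s k ≤ wordBound n := fun k => (hinv.lt k).le.trans (hinv.le_bound k)
    have h1 := hR.next (by decide) (step_loop P s t u) (wordsLE_mem hsW hinv.le_bound hNpos)
    by_cases hc : t 0 < 3 * n 0 ∨ t 1 < 3 * n 1
    swap
    · exact exists_outcome_of_exit hj hI hR hinv hc
    have hIlt := hinv.iterations_lt hc
    rw [if_pos hc] at h1
    have h2 := h1.next_visit (step_left P s t u) (wordsLE_mem hsW hinv.le_bound hNpos)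
    by_cases hl : Left P s t u
    swap
    · rw [if_neg hl] at h2
      have hinv' := hinv.skip hc hl
      have h3 := h2.next (by decide) (step_incr_t P s t u) (wordsLE_mem hsW hinv'.le_bound hNpos)
      have h4 := h3.next (by decide) (step_flip_u P s _ u) (wordsLE_mem hsW hinv'.le_bound hNpos)
      have h5 := h4.next (by decide) (step_goto P _) (wordsLE_mem hsW hinv'.le_bound hNpos)
      exact ih _ _ _ _ _ (by omega) (by omega) (by omega) h5 hinv'
    rw [if_pos hl] at h2
    have h3 := h2.next (by decide) (step_bound P s t u) (wordsLE_mem hsW hinv.le_bound hNpos)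
    by_cases ht : t u < 2 * n u
    swap
    · rw [if_neg ht] at h3
      have h4 := h3.next (by decide) (step_null P _) trivial
      refine ⟨_, _, ⟨I + 1, by omega, h4⟩, by omega, fun s₀ s₁ h => (by cases h), fun _ => ?_⟩
      -- The refused move would still keep `B`, which therefore holds at an index that is at least
      -- `2 * n u`.
      exact ⟨u, t u, s (1 - u),
        hB.advance u (s u) (t u) _ (hinv.bounded u) (hinv.not_left u) hl, not_lt.1 ht⟩
    rw [if_pos ht] at h3
    have hinv' := hinv.move hB hl ht hc
    have hsW' : ∀ k, Function.update s u (t u) k ≤ wordBound n :=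
      fun k => (hinv'.lt k).le.trans (hinv'.le_bound k)
    have hu' : Function.update s u (t u) (1 - u) = s (1 - u) :=
      Function.update_of_ne (one_sub_ne u) ..
    have htu : Function.update t (1 - u) (s (1 - u) + 1) u = t u :=
      Function.update_of_ne (one_sub_ne u).symm ..
    have htW : ∀ k, Function.update t (1 - u) (s (1 - u) + 1) k ≤ wordBound n := by
      rw [forall_fin_two_iff u, htu, Function.update_self]
      exact ⟨hinv.le_bound u, (hinv.lt (1 - u)).trans (hinv.t_lt hc _) |>.trans_le le_rfl⟩
    have h4 := h3.next (by decide) (step_store_s P s t u) (wordsLE_mem hsW' hinv.le_bound hNpos)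
    have hstep := step_reset_t P (Function.update s u (t u)) t u
    rw [hu'] at hstep
    have h5 := h4.next (by decide) hstep (wordsLE_mem hsW' htW hNpos)
    have hstep' := step_incr_t P (Function.update s u (t u))
      (Function.update t (1 - u) (s (1 - u) + 1)) u
    rw [htu] at hstep'
    have h6 := h5.next (by decide) hstep' (wordsLE_mem hsW' hinv'.le_bound hNpos)
    have h7 := h6.next (by decide) (step_flip_u P _ _ u) (wordsLE_mem hsW' hinv'.le_bound hNpos)
    have h8 := h7.next (by decide) (step_goto P _) (wordsLE_mem hsW' hinv'.le_bound hNpos)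
    exact ih _ _ _ _ _ (by omega) (by omega) (by omega) h8 hinv'

variable (P)

/-- Covers the times before the loop: the loop body is not visited and the words are at most `1`. -/
lemma run_init (i : ℕ) (hi : i ≤ 5) :
    ∃ m, run P separatingCommonTangent algWords i = .running i m ∧ ∀ a, m a ≤ 1 := by
  induction i with
  | zero => exact ⟨fun _ => 0, rfl, fun _ => Nat.zero_le _⟩
  | succ i ih =>
    obtain ⟨m, hm, hle⟩ := ih (by omega)
    rw [run_succ, hm]
    have hi' : i < 5 := hi
    interval_cases i <;>
    · simp only [step, separatingCommonTangent, Instr.exec, NExp.eval, Alg.sAddr, Alg.tAddr,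
        Alg.uAddr, List.getElem?_cons_zero, List.getElem?_cons_succ]
      exact ⟨_, rfl, fun a => (ite_le_sup _ _ _).trans (sup_le (by norm_num) (hle a))⟩

lemma reaches_loop : Reaches P 5 0 (.running 5 (mem 0 1 0)) := by
  refine ⟨run_five P, ?_, fun i hi => ?_⟩
  · classical
    unfold visits
    rw [Nat.le_zero, Finset.card_eq_zero, Finset.filter_eq_empty_iff]
    intro i hi
    have hi' := Finset.mem_range.1 hi
    obtain ⟨m, hm, -⟩ := run_init P i (by omega)
    rw [hm]
    change ¬ i = 6
    omega
  · obtain ⟨m, hm, hle⟩ := run_init P i hi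
    rw [hm]
    exact fun a => (hle a).trans (one_le_wordBound n)

lemma loopInvariant_init {B : Fin 2 → ℕ → ℕ → Prop} (hB : KeptByMoves P B) :
    LoopInvariant P B 0 0 1 0 := by
  have h0 : ∀ k, 0 < n k := fun k => Nat.pos_of_ne_zero (NeZero.ne _)
  refine ⟨fun k => Nat.zero_lt_one, fun k => ?_, fun k => ?_, le_rfl, Nat.le_succ _, le_rfl,
    fun k i hi hi' => ?_, fun k => hB.zero _ _⟩
  · have := h0 k
    simp only [Pi.zero_apply]
    omega
  · have := h0 0
    unfold wordBound
    simp only [Pi.one_apply]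
    omega
  · obtain rfl : i = 0 := by simpa using hi'
    exact orient_right _ _

/-- The program halts. -/
lemma exists_outcome {B : Fin 2 → ℕ → ℕ → Prop} (hB : KeptByMoves P B) :
    ∃ T output, Outcome P B T output :=
  exists_outcome_of_reaches hB (wordBound n) 5 0 0 1 0 (by omega) (by omega) (by omega)
    (reaches_loop P) (loopInvariant_init P hB)

variable {P}

lemma Outcome.run_eq {B : Fin 2 → ℕ → ℕ → Prop} {T : ℕ} {output : Option (ℕ × ℕ)}
    (h : Outcome P B T output) : run P separatingCommonTangent algWords T = .halted output := by
  obtain ⟨I, -, hI⟩ := h.reaches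
  exact hI.run_eq

lemma Outcome.wordsLE {B : Fin 2 → ℕ → ℕ → Prop} {T : ℕ} {output : Option (ℕ × ℕ)}
    (h : Outcome P B T output) (j : ℕ) :
    (run P separatingCommonTangent algWords j).WordsLE (wordBound n) := by
  obtain ⟨I, -, hI⟩ := h.reaches
  rcases Nat.le_total j T with hj | hj
  · exact hI.wordsLE j hj
  · have : ∀ i, run P separatingCommonTangent algWords (T + i) = .halted output := by
      intro i
      induction i with
      | zero => exact hI.run_eq
      | succ i ih =>
        rw [← add_assoc, run_succ, ih]
        rfl
    rw [← Nat.add_sub_cancel' hj, this]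
    trivial

end Loop

end SepTangent

end

/-! ### The main theorem -/

open SepTangent in
theorem theorem1 :
    ∃ C : ℕ, ∀ (n : Fin 2 → ℕ) [∀ k, NeZero (n k)] (P : (k : Fin 2) → Polygon Plane (n k)),
      (∀ k, IsSimple (P k)) → (∀ k, IsCounterclockwise (P k)) → GeneralPosition P →
      ∃ (T : ℕ) (output : Option (ℕ × ℕ)),
        -- the algorithm halts with this output
        run P separatingCommonTangent algWords T = .halted output ∧
        -- linear time
        runTime P separatingCommonTangent algWords T ≤ C * (n 0 + n 1) ∧
        visits P separatingCommonTangent algWords loopBodyLine T ≤ 6 * (n 0 + n 1) ∧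
        -- constant workspace
        (∀ j, (run P separatingCommonTangent algWords j).bits ≤ C * Nat.log 2 (n 0 + n 1)) ∧
        -- separating common tangents exist
        ((∃ ℓ, IsSeparatingCommonTangent ℓ ((P 0).boundary ℝ) ((P 1).boundary ℝ)) →
          ∃ s : Fin 2 → ℕ, output = some (s 0, s 1) ∧
            corner (P 0) (s 0) ≠ corner (P 1) (s 1) ∧
            IsSeparatingCommonTangent (lineThrough (corner (P 0) (s 0)) (corner (P 1) (s 1)))
              ((P 0).boundary ℝ) ((P 1).boundary ℝ) ∧
            ∀ k, (P k).boundary ℝ ⊆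
              RHP (corner (P (1 - k)) (s (1 - k))) (corner (P k) (s k))) ∧
        -- no separating common tangent exists
        ((¬ ∃ ℓ, IsSeparatingCommonTangent ℓ ((P 0).boundary ℝ) ((P 1).boundary ℝ)) →
          output = none) ∧
        -- the output decides whether the convex hulls are disjoint
        (output ≠ none ↔
          Disjoint (convexHull ℝ ((P 0).boundary ℝ)) (convexHull ℝ ((P 1).boundary ℝ))) := by
  -- With `N = n 0 + n 1`, there are at most `8 * (6 * N) + 8` steps of cost at most `100`, and
  -- `4800 * N + 800 ≤ 5000 * N` since `N ≥ 6`. The workspace needs only the factor `15`.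
  refine ⟨5000, fun n _ P hP hccw hgp => ?_⟩
  have hn : 6 ≤ n 0 + n 1 := by
    have h0 := (hP 0).three_le
    have h1 := (hP 1).three_le
    omega
  obtain ⟨B, hB, hnull⟩ : ∃ B, KeptByMoves P B ∧
      (Disjoint (convexHull ℝ ((P 0).boundary ℝ)) (convexHull ℝ ((P 1).boundary ℝ)) →
        ∀ k s j, B k s j → s < 2 * n k) := by
    by_cases hdisj :
        Disjoint (convexHull ℝ ((P 0).boundary ℝ)) (convexHull ℝ ((P 1).boundary ℝ))
    · obtain ⟨B, h1, h2, h3, h4⟩ := exists_bounding_invariant hP hccw hgp hdisj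
      exact ⟨B, ⟨h1, h2, h3⟩, fun _ => h4⟩
    -- For intersecting hulls no index bound is needed: a returned pair would make the hulls
    -- disjoint, so termination alone gives NULL.
    · exact ⟨fun _ _ _ => True, ⟨fun _ _ => trivial, fun _ _ _ _ _ _ _ => trivial,
        fun _ _ _ _ _ _ => trivial⟩, fun h => absurd h hdisj⟩
  obtain ⟨T, output, hout⟩ := exists_outcome P hB
  have hpair : ∀ o, output = some o → IsTangentPair P ![o.1, o.2] := fun o ho =>
    hout.tangent o.1 o.2 ho
  have hsome : Disjoint (convexHull ℝ ((P 0).boundary ℝ)) (convexHull ℝ ((P 1).boundary ℝ)) →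
      output ≠ none := by
    intro hdisj ho
    obtain ⟨k, s, j, h1, h2⟩ := hout.null ho
    exact (hnull hdisj k s j h1).not_ge h2
  refine ⟨T, output, hout.run_eq, ?_, ?_, fun j => ?_, ?_, ?_, ?_⟩
  · have h1 := runTime_le P algWords T
    have h2 := hout.time_le
    unfold wordBound at h2
    omega
  · obtain ⟨I, hI, hR⟩ := hout.reaches
    exact hR.visits_le.trans hI
  · refine (bits_le (hout.wordsLE j) (wordBound_lt hn)).trans ?_
    unfold algWords
    omega
  · rintro ⟨ℓ, hℓ⟩
    obtain ⟨o, ho⟩ := Option.ne_none_iff_exists'.1 (hsome (disjoint_of_separating hgp hℓ))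
    have hs := hpair o ho
    exact ⟨![o.1, o.2], ho, hgp.corner_ne 1 _ _, hs.isSeparatingCommonTangent hP hgp,
      hs.subset_RHP⟩
  · intro hno
    by_contra ho
    obtain ⟨o, ho⟩ := Option.ne_none_iff_exists'.1 ho
    exact hno ⟨_, (hpair o ho).isSeparatingCommonTangent hP hgp⟩
  · refine ⟨fun ho => ?_, hsome⟩
    obtain ⟨o, ho⟩ := Option.ne_none_iff_exists'.1 ho
    exact (hpair o ho).disjoint_convexHull hgp
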